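/- **Theorem 3 (convergence of the compact scheme).** Let $0<\alpha<1$, $l,T,c_1>0$, let $k,q:[0,T]\to\mathbb R$ with $c_1\le k(t)$, $k$ bounded, and $q(t)\ge 0$, and let $f$ be such that $f(\cdot,t)$ is continuous on $[0,l]$ for every $t\in(0,T]$. Let $u$ be a solution of $$\partial_{0t}^{\alpha}u=\frac{\partial}{\partial x}\Big(k(t)\frac{\partial u}{\partial x}\Big)-q(t)u+f(x,t),\quad 0<x<l,\ 0<t\le T,$$ $$u(0,t)=u(l,t)=0\ (0\le t\le T),\qquad u(x,0)=u_0(x)\ (0\le x\le l),$$ where $\partial_{0t}^{\alpha}u(x,t)=\frac1{\Gamma(1-\alpha)}\int_0^t\frac{\partial u}{\partial\eta}(x,\eta)(t-\eta)^{-\alpha}\,d\eta$, and let $u\in\mathcal C^{6,3}_{x,t}([0,l]\times[0,T])$, i.e. $\partial_x^iu$ $(i\le 6)$ and $\partial_t^pu$ $(p\le 3)$ exist and are continuous on $[0,l]\times[0,T]$. For integers $N,M\ge1$ put $h=l/N$, $\tau=T/M$, $x_i=ih$, $t_j=j\tau$. For grid functions put $v_{\bar x,i}=(v_i-v_{i-1})/h$,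 $v_{\bar xx,i}=(v_{i+1}-2v_i+v_{i-1})/h^2$, $\mathcal H_hv_i=v_i+\frac{h^2}{12}v_{\bar xx,i}$, $\|v\|_0^2=\sum_{i=1}^{N-1}v_i^2h$, $\|v]|_0^2=\sum_{i=1}^{N}v_i^2h$. For $j\ge1$ let $$\Delta^\alpha_{0t_{j+1}}v=\frac{\tau^{1-\alpha}}{\Gamma(2-\alpha)}\sum_{s=0}^{j}c_{j-s}\frac{v^{s+1}-v^s}{\tau},$$ where, with $a_s=(s+1)^{1-\alpha}-s^{1-\alpha}$ and $b_s=\frac{(s+1)^{2-\alpha}-s^{2-\alpha}}{2-\alpha}-\frac{(s+1)^{1-\alpha}+s^{1-\alpha}}2$, the coefficients are: for $j=1$, $c_0=a_0+b_0+b_1$ and $c_1=a_1-b_1-b_0$; for $j\ge2$, $c_0=a_0+b_0$, $c_s=a_s+b_s-b_{s-1}$ $(1\le s\le j-2)$, $c_{j-1}=a_{j-1}+b_{j-1}+b_j-b_{j-2}$, $c_j=a_j-b_j-b_{j-1}$. Then for every constant $C_1$ there is a constant $C_R>0$, independent of $\tau$ and $h$, such that for all $N,M\ge1$ the following holds. Let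 $\{y_i^j: 0\le i\le N,\ 0\le j\le M\}$ satisfy the compact scheme $$\Delta_{0t_{j+1}}^{\alpha}\mathcal H_hy_i=k(t_{j+1})\,y^{j+1}_{\bar xx,i}-q(t_{j+1})\,\mathcal H_hy^{j+1}_i+\mathcal H_h\varphi_i^{j+1},\quad 1\le i\le N-1,\ 1\le j\le M-1,$$ with $\varphi_i^{j+1}=f(x_i,t_{j+1})$, $y_0^j=y_N^j=0$ $(0\le j\le M)$ and $y_i^0=u_0(x_i)$ $(0\le i\le N)$, and suppose that the first layer $y^1$ (which these equations do not determine) is accurate to the order of the scheme, that is, $z_i^j=u(x_i,t_j)-y_i^j$ satisfies $\|z^1\|_0\le C_1(\tau^{3-\alpha}+h^4)$. Then $$\sqrt{\sum_{j=1}^{M-1}\big(\|z^{j+1}\|_0^2+\|z_{\bar x}^{j+1}]|_0^2\big)\tau}\ \le\ C_R\,(\tau^{3-\alpha}+h^4).$$ -/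

import Mathlib

open Set

noncomputable section

namespace CompactScheme

/-! The continuous problem. -/

/-- The Caputo derivative of order `α` of `v`, with lower limit `0`, at the point `t`. -/
def caputo (α : ℝ) (v : ℝ → ℝ) (t : ℝ) : ℝ :=
  1 / Real.Gamma (1 - α) * ∫ η in (0 : ℝ)..t, deriv v η * (t - η) ^ (-α)

/-- `(𝓛u)(x,t) = ∂ₓ (k(x,t) ∂ₓ u(x,t)) - q(x,t) u(x,t)`. -/
def diffusionOp (k q u : ℝ → ℝ → ℝ) (x t : ℝ) : ℝ :=
  deriv (fun ξ => k ξ t * deriv (fun η => u η t) ξ) x - q x t * u x t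

/-- `u` solves the initial-boundary value problem for the time-fractional diffusion equation
`∂₀ₜ^α u = 𝓛u + f` on `0 < x < l`, `0 < t ≤ T`. -/
structure IsSolution (α l T : ℝ) (k q f : ℝ → ℝ → ℝ) (u₀ : ℝ → ℝ) (u : ℝ → ℝ → ℝ) : Prop where
  equation : ∀ x ∈ Ioo 0 l, ∀ t ∈ Ioc 0 T,
    caputo α (fun s => u x s) t = diffusionOp k q u x t + f x t
  left : ∀ t ∈ Icc 0 T, u 0 t = 0
  right : ∀ t ∈ Icc 0 T, u l t = 0
  initial : ∀ x ∈ Icc 0 l, u x 0 = u₀ x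

/-- The class `𝓒^{m,n}_{x,t}` on the closed rectangle `[0,l] × [0,T]`: the derivatives
`∂ₓ^i u`, `i ≤ m`, and `∂ₜ^p u`, `p ≤ n`, exist up to the boundary (one-sided there) and are
jointly continuous on the closed rectangle. No mixed derivatives are required. -/
structure IsC (m n : ℕ) (l T : ℝ) (u : ℝ → ℝ → ℝ) : Prop where
  contDiff_x : ∀ t ∈ Icc 0 T, ContDiffOn ℝ m (fun x => u x t) (Icc 0 l)
  contDiff_t : ∀ x ∈ Icc 0 l, ContDiffOn ℝ n (fun t => u x t) (Icc 0 T)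
  continuous_x : ∀ i ≤ m, ContinuousOn
    (fun p : ℝ × ℝ => iteratedDerivWithin i (fun x => u x p.2) (Icc 0 l) p.1)
    (Icc 0 l ×ˢ Icc 0 T)
  continuous_t : ∀ i ≤ n, ContinuousOn
    (fun p : ℝ × ℝ => iteratedDerivWithin i (fun t => u p.1 t) (Icc 0 T) p.2)
    (Icc 0 l ×ˢ Icc 0 T)

/-! The L2 formula for the Caputo derivative. -/

/-- `a_s^{(α)} = (s+1)^{1-α} - s^{1-α}`. -/
def aCoeff (α : ℝ) (s : ℕ) : ℝ :=
  ((s : ℝ) + 1) ^ (1 - α) - (s : ℝ) ^ (1 - α)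

/-- `b_s^{(α)} = ((s+1)^{2-α} - s^{2-α}) / (2-α) - ((s+1)^{1-α} + s^{1-α}) / 2`. -/
def bCoeff (α : ℝ) (s : ℕ) : ℝ :=
  1 / (2 - α) * (((s : ℝ) + 1) ^ (2 - α) - (s : ℝ) ^ (2 - α))
    - 1 / 2 * (((s : ℝ) + 1) ^ (1 - α) + (s : ℝ) ^ (1 - α))

/-- The coefficient `c_s^{(α)}`, `0 ≤ s ≤ j`, of the L2 formula at the time level `t_{j+1}`,
`j ≥ 1` (it depends on `j`; the case `j = 2` falls under the general formulas). -/
def cCoeff (α : ℝ) (j s : ℕ) : ℝ :=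
  if j = 1 then
    if s = 0 then aCoeff α 0 + bCoeff α 0 + bCoeff α 1
    else aCoeff α 1 - bCoeff α 1 - bCoeff α 0
  else if s = 0 then aCoeff α 0 + bCoeff α 0
  else if s = j then aCoeff α j - bCoeff α j - bCoeff α (j - 1)
  else if s = j - 1 then
    aCoeff α (j - 1) + bCoeff α (j - 1) + bCoeff α j - bCoeff α (j - 2)
  else aCoeff α s + bCoeff α s - bCoeff α (s - 1)

/-- The L2 formula `Δ^α_{0 t_{j+1}} v`, `j ≥ 1`, on the uniform time grid of step `τ`. -/
def l2Formula (α τ : ℝ) (v : ℕ → ℝ) (j : ℕ) : ℝ :=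
  τ ^ (1 - α) / Real.Gamma (2 - α) *
    ∑ s ∈ Finset.range (j + 1), cCoeff α j (j - s) * ((v (s + 1) - v s) / τ)

/-! Spatial grid functions `v_0, …, v_N` with step `h`. -/

/-- The backward difference `v_{x̄,i}`, `1 ≤ i ≤ N`. -/
def backDiff (h : ℝ) (v : ℕ → ℝ) (i : ℕ) : ℝ := (v i - v (i - 1)) / h

/-- The second difference `v_{x̄x,i}`, `1 ≤ i ≤ N - 1`. -/
def secondDiff (h : ℝ) (v : ℕ → ℝ) (i : ℕ) : ℝ := (v (i + 1) - 2 * v i + v (i - 1)) / h ^ 2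

/-- The averaging operator `(𝓗_h v)_i = v_i + h² v_{x̄x,i} / 12`, `1 ≤ i ≤ N - 1`. -/
def avg (h : ℝ) (v : ℕ → ℝ) (i : ℕ) : ℝ := v i + h ^ 2 * secondDiff h v i / 12

/-- `‖v‖₀² = ∑_{i=1}^{N-1} v_i² h`. -/
def normSq (N : ℕ) (h : ℝ) (v : ℕ → ℝ) : ℝ := ∑ i ∈ Finset.Ico 1 N, v i ^ 2 * h

/-- `‖v]|₀² = ∑_{i=1}^{N} v_i² h`. -/
def normSqR (N : ℕ) (h : ℝ) (v : ℕ → ℝ) : ℝ := ∑ i ∈ Finset.Icc 1 N, v i ^ 2 * h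

/-- `y j i` (`0 ≤ j ≤ M`, `0 ≤ i ≤ N`) solves the compact difference scheme with steps
`h = l / N`, `τ = T / M`, for coefficients `k = k(t)`, `q = q(t)`. The scheme equations are
imposed on the levels `t_{j+1}`, `1 ≤ j ≤ M - 1`, where the L2 formula is defined; the layer
`y 1` is not determined by them. -/
structure IsSchemeSolution (α l T : ℝ) (k q : ℝ → ℝ) (f : ℝ → ℝ → ℝ) (u₀ : ℝ → ℝ)
    (N M : ℕ) (y : ℕ → ℕ → ℝ) : Prop where
  equation : ∀ j ∈ Finset.Ico 1 M, ∀ i ∈ Finset.Ico 1 N,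
    l2Formula α (T / M) (fun s => avg (l / N) (y s) i) j
      = k ((j + 1 : ℕ) * (T / M)) * secondDiff (l / N) (y (j + 1)) i
        - q ((j + 1 : ℕ) * (T / M)) * avg (l / N) (y (j + 1)) i
        + avg (l / N) (fun r => f (r * (l / N)) ((j + 1 : ℕ) * (T / M))) i
  left : ∀ j ≤ M, y j 0 = 0
  right : ∀ j ≤ M, y j N = 0
  initial : ∀ i ≤ N, y 0 i = u₀ (i * (l / N))

/-- The error `z_i^j = u(x_i, t_j) - y_i^j`. -/
def gridError (h τ : ℝ) (u : ℝ → ℝ → ℝ) (y : ℕ → ℕ → ℝ) (j i : ℕ) : ℝ :=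
  u (i * h) (j * τ) - y j i

end CompactScheme

end

noncomputable section

namespace CompactScheme

/-! The error `z` satisfies the homogeneous scheme up to a residual, so convergence is consistency
plus stability.

Stability comes from testing the error equation with `avg h z^{j+1}`. Since `k` depends on `t` only,
it factors out of the spatial sum, and `-(z_xx, avg z)` dominates `2/3` of the squared gradient
norm. What remains is to bound the time term, `w (j+1)` times the L2 formula of `w`, from below
after summation over `j`, where `w` is the averaged error at a fixed node. The usual argument for
nonnegative decreasing weights fails: the second L2 coefficient is negative for `α` near 1. The
remedy is to split off `b₀` times the BDF2 stencil `3w_{j+1} - 4w_j + w_{j-1}`, which carries its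
own quadratic energy (G-stability). The remaining coefficients `mCorr` are nonnegative and
decreasing, so a convexity inequality applies to them. Together they give a telescoping energy
(`energy_step`). The special coefficients on the first time interval cost only multiples of `w 1 ^
2`, and the sum of these costs is at most of order `M ^ (1 - α)`; this is why only the first layer
enters the a priori estimate `sum_normSqR_le`.

Consistency has two parts. In time, the L2 formula integrates the derivative of a piecewise
quadratic interpolant exactly against the kernel; the interpolation error vanishes at the nodes, so
away from the singularity only the variation of the kernel counts, and it telescopes to a bound of
order `τ ^ (3 - α)` uniform in `j` (`abs_l2Formula_sub_caputo_le`). In space, `avg` of the second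
derivative agrees with the second difference to order `h ^ 4` (`abs_avg_sub_secondDiff_le`). Both
enter `abs_residual_le`. -/

/-! ### Convexity inequality for decreasing weights -/

open Finset in
theorem mul_le_sum_mul_sub (m D : ℕ → ℝ) (n : ℕ) (hD₀ : D 0 = 0) (hD : ∀ s, 0 ≤ D s)
    (hm : ∀ s < n, m (s + 1) ≤ m s) :
    m n * D (n + 1) ≤ ∑ s ∈ range (n + 1), m s * (D (s + 1) - D s) := by
  induction n with
  | zero => simp [hD₀]
  | succ n ih =>
    rw [sum_range_succ]
    have h₁ := ih fun s hs => hm s (by omega)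
    have h₂ := mul_nonneg (sub_nonneg.2 (hm n (by omega))) (hD (n + 1))
    nlinarith

-- Each `2 w_{n+1} (w_{n+1-s} - w_{n-s})` equals the difference of squares plus an increment of `D s
-- = (w_{n+1} - w_{n+1-s})²`. As `D 0 = 0` and `D ≥ 0`, Abel summation against decreasing weights
-- makes the weighted sum of the increments nonnegative.
open Finset in
theorem sum_mul_sq_sub_sq_le (m w : ℕ → ℝ) (n : ℕ) (hm : ∀ s < n, m (s + 1) ≤ m s)
    (hn : 0 ≤ m n) :
    ∑ s ∈ range (n + 1), m s * (w (n + 1 - s) ^ 2 - w (n - s) ^ 2) ≤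
      2 * w (n + 1) * ∑ s ∈ range (n + 1), m s * (w (n + 1 - s) - w (n - s)) := by
  have h := mul_le_sum_mul_sub m (fun s => (w (n + 1) - w (n + 1 - s)) ^ 2) n (by simp)
    (fun s => sq_nonneg _) hm
  have h₀ : 0 ≤ m n * (w (n + 1) - w (n + 1 - (n + 1))) ^ 2 := mul_nonneg hn (sq_nonneg _)
  have h₁ := h₀.trans h
  simp only [Nat.add_sub_add_right] at h₁
  have e : 2 * w (n + 1) * ∑ s ∈ range (n + 1), m s * (w (n + 1 - s) - w (n - s)) =
      ∑ s ∈ range (n + 1), m s * (w (n + 1 - s) ^ 2 - w (n - s) ^ 2) +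
      ∑ s ∈ range (n + 1),
        m s * ((w (n + 1) - w (n - s)) ^ 2 - (w (n + 1) - w (n + 1 - s)) ^ 2) := by
    rw [mul_sum, ← sum_add_distrib]
    exact sum_congr rfl fun s _ => by ring
  linarith

/-! ### Sign, monotonicity and size of the coefficients `a_s` and `b_s` -/

theorem aCoeff_zero {α : ℝ} (hα : α < 1) : aCoeff α 0 = 1 := by
  simp [aCoeff, Real.zero_rpow (show 1 - α ≠ 0 by linarith)]

theorem bCoeff_zero {α : ℝ} (hα : α < 1) : bCoeff α 0 = 1 / (2 - α) - 1 / 2 := by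
  simp [bCoeff, Real.zero_rpow (show 1 - α ≠ 0 by linarith),
    Real.zero_rpow (show 2 - α ≠ 0 by linarith)]

theorem sum_aCoeff {α : ℝ} (hα : α < 1) (n : ℕ) :
    ∑ s ∈ Finset.range n, aCoeff α s = (n : ℝ) ^ (1 - α) := by
  have := Finset.sum_range_sub (fun s : ℕ => (s : ℝ) ^ (1 - α)) n
  simpa [aCoeff, Real.zero_rpow (show 1 - α ≠ 0 by linarith)] using this

/-- `b_s` is the error of the trapezoidal rule for `x ^ (1 - α)` on `[s, s+1]`, and this is its
Peano kernel form; the antiderivative below results from two integrations by parts. Sign,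
monotonicity and decay of `b_s` are all read off from it. The condition `1 ≤ s` keeps the
singularity at `0` away. -/
theorem bCoeff_eq_integral {α : ℝ} (hα1 : α < 1) {s : ℕ} (hs : 1 ≤ s) :
    bCoeff α s = α * (1 - α) / 2 *
      ∫ t in (0 : ℝ)..1, t * (1 - t) * ((s : ℝ) + t) ^ (-α - 1) := by
  have hs' : (1 : ℝ) ≤ s := by exact_mod_cast hs
  have hpos : ∀ t ∈ uIcc (0 : ℝ) 1, 0 < (s : ℝ) + t := fun t ht => by
    rw [uIcc_of_le zero_le_one] at ht; linarith [ht.1]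
  have key : ∫ t in (0 : ℝ)..1, α * (1 - α) / 2 * (t * (1 - t) * ((s : ℝ) + t) ^ (-α - 1)) =
      (fun t : ℝ => 1 / (2 - α) * ((s : ℝ) + t) ^ (2 - α) +
        (1 - 2 * t) / 2 * ((s : ℝ) + t) ^ (1 - α) -
        (1 - α) / 2 * (t * (1 - t)) * ((s : ℝ) + t) ^ (-α)) 1 -
      (fun t : ℝ => 1 / (2 - α) * ((s : ℝ) + t) ^ (2 - α) +
        (1 - 2 * t) / 2 * ((s : ℝ) + t) ^ (1 - α) -
        (1 - α) / 2 * (t * (1 - t)) * ((s : ℝ) + t) ^ (-α)) 0 := by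
    apply intervalIntegral.integral_eq_sub_of_hasDerivAt (f := (fun t : ℝ => 1 / (2 - α) * ((s : ℝ) + t) ^ (2 - α) +
        (1 - 2 * t) / 2 * ((s : ℝ) + t) ^ (1 - α) -
        (1 - α) / 2 * (t * (1 - t)) * ((s : ℝ) + t) ^ (-α)))
    · intro t ht
      have hp := hpos t ht
      have hd : ∀ p : ℝ, HasDerivAt (fun t : ℝ => ((s : ℝ) + t) ^ p)
          (p * ((s : ℝ) + t) ^ (p - 1)) t := fun p => by
        have := ((hasDerivAt_id t).const_add (s : ℝ)).rpow_const (p := p) (Or.inl hp.ne')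
        simpa using this
      have h₁ : HasDerivAt (fun t : ℝ => (1 - 2 * t) / 2) (-1) t := by
        have := (((hasDerivAt_id t).const_mul 2).const_sub 1).div_const 2
        exact this.congr_deriv (by norm_num)
      have h₂ : HasDerivAt (fun t : ℝ => (1 - α) / 2 * (t * (1 - t)))
          ((1 - α) / 2 * (1 - 2 * t)) t := by
        have := ((hasDerivAt_id t).mul ((hasDerivAt_id t).const_sub 1)).const_mul ((1 - α) / 2)
        exact this.congr_deriv (by simp only [id]; ring)
      have := (((hd (2 - α)).const_mul (1 / (2 - α))).add (h₁.mul (hd (1 - α)))).sub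
        (h₂.mul (hd (-α)))
      refine this.congr_deriv ?_
      have e₁ : (2 - α - 1) = 1 - α := by ring
      have e₂ : (1 - α - 1) = -α := by ring
      rw [e₁, e₂]
      have : (2 - α) ≠ 0 := by linarith
      field_simp
      ring
    · apply ContinuousOn.intervalIntegrable
      intro t ht
      have hp := hpos t ht
      apply ContinuousAt.continuousWithinAt
      have : ContinuousAt (fun t : ℝ => ((s : ℝ) + t) ^ (-α - 1)) t :=
        ContinuousAt.rpow_const (by fun_prop) (Or.inl hp.ne')
      fun_prop
  rw [intervalIntegral.integral_const_mul] at key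
  rw [key, bCoeff]
  norm_num
  ring

theorem intervalIntegrable_kernel (α : ℝ) {s : ℕ} (hs : 1 ≤ s) :
    IntervalIntegrable (fun t : ℝ => t * (1 - t) * ((s : ℝ) + t) ^ (-α - 1))
      MeasureTheory.volume 0 1 := by
  have hs' : (1 : ℝ) ≤ s := by exact_mod_cast hs
  apply ContinuousOn.intervalIntegrable
  intro t ht
  rw [uIcc_of_le zero_le_one] at ht
  apply ContinuousAt.continuousWithinAt
  have : ContinuousAt (fun t : ℝ => ((s : ℝ) + t) ^ (-α - 1)) t :=
    ContinuousAt.rpow_const (by fun_prop) (Or.inl (by linarith [ht.1]))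
  fun_prop

theorem bCoeff_nonneg {α : ℝ} (hα0 : 0 < α) (hα1 : α < 1) (s : ℕ) : 0 ≤ bCoeff α s := by
  rcases Nat.eq_zero_or_pos s with rfl | hs
  · rw [bCoeff_zero hα1, sub_nonneg]
    apply one_div_le_one_div_of_le <;> linarith
  · rw [bCoeff_eq_integral hα1 hs]
    refine mul_nonneg (by nlinarith) (intervalIntegral.integral_nonneg zero_le_one fun t ht => ?_)
    exact mul_nonneg (mul_nonneg ht.1 (by linarith [ht.2]))
      (Real.rpow_nonneg (by linarith [ht.1, (Nat.cast_nonneg s : (0 : ℝ) ≤ s)]) _)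

theorem bCoeff_succ_le {α : ℝ} (hα0 : 0 < α) (hα1 : α < 1) {s : ℕ} (hs : 1 ≤ s) :
    bCoeff α (s + 1) ≤ bCoeff α s := by
  have hs' : (1 : ℝ) ≤ s := by exact_mod_cast hs
  rw [bCoeff_eq_integral hα1 hs, bCoeff_eq_integral hα1 (by omega : 1 ≤ s + 1)]
  refine mul_le_mul_of_nonneg_left ?_ (by nlinarith)
  refine intervalIntegral.integral_mono_on zero_le_one (intervalIntegrable_kernel α (by omega))
    (intervalIntegrable_kernel α hs) fun t ht => ?_
  refine mul_le_mul_of_nonneg_left ?_ (mul_nonneg ht.1 (by linarith [ht.2]))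
  apply Real.rpow_le_rpow_of_nonpos (by linarith [ht.1]) (by push_cast; linarith) (by linarith)

theorem bCoeff_le {α : ℝ} (hα0 : 0 < α) (hα1 : α < 1) {s : ℕ} (hs : 1 ≤ s) :
    bCoeff α s ≤ α * (1 - α) / 12 * (s : ℝ) ^ (-α - 1) := by
  have hs' : (1 : ℝ) ≤ s := by exact_mod_cast hs
  rw [bCoeff_eq_integral hα1 hs]
  have h : ∫ t in (0 : ℝ)..1, t * (1 - t) * ((s : ℝ) + t) ^ (-α - 1) ≤
      ∫ t in (0 : ℝ)..1, t * (1 - t) * (s : ℝ) ^ (-α - 1) := by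
    refine intervalIntegral.integral_mono_on zero_le_one (intervalIntegrable_kernel α hs)
      (Continuous.intervalIntegrable (by fun_prop) _ _) fun t ht => ?_
    refine mul_le_mul_of_nonneg_left ?_ (mul_nonneg ht.1 (by linarith [ht.2]))
    apply Real.rpow_le_rpow_of_nonpos (by linarith) (by linarith [ht.1]) (by linarith)
  have e : ∫ t in (0 : ℝ)..1, t * (1 - t) = 1 / 6 := by
    have : ∀ t : ℝ, t * (1 - t) = t - t ^ 2 := fun t => by ring
    simp only [this]
    rw [intervalIntegral.integral_sub (by simp) (by simp)]
    simp; norm_num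
  rw [intervalIntegral.integral_mul_const, e] at h
  calc _ ≤ α * (1 - α) / 2 * (1 / 6 * (s : ℝ) ^ (-α - 1)) :=
        mul_le_mul_of_nonneg_left h (by nlinarith)
    _ = _ := by ring

/-- Concavity of `x ^ (1 - α)`: the increment over `[s, s+1]` is at least the slope at the right
end. Bernoulli's inequality, applied to `s = (s+1)(1 - 1/(s+1))`, also covers `s = 0`. -/
theorem le_aCoeff {α : ℝ} (hα0 : 0 < α) (hα1 : α < 1) (s : ℕ) :
    (1 - α) * ((s : ℝ) + 1) ^ (-α) ≤ aCoeff α s := by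
  have hs : (0 : ℝ) ≤ s := Nat.cast_nonneg s
  have hpos : (0 : ℝ) < s + 1 := by linarith
  have h := rpow_one_add_le_one_add_mul_self (s := -1 / ((s : ℝ) + 1)) (p := 1 - α)
    (by rw [le_div_iff₀ hpos]; linarith) (by linarith) (by linarith)
  have e : (s : ℝ) = ((s : ℝ) + 1) * (1 + -1 / ((s : ℝ) + 1)) := by field_simp; ring
  have e₂ : (s : ℝ) ^ (1 - α) =
      ((s : ℝ) + 1) ^ (1 - α) * (1 + -1 / ((s : ℝ) + 1)) ^ (1 - α) := by
    rw [← Real.mul_rpow hpos.le (by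
      rw [show (1 : ℝ) + -1 / ((s : ℝ) + 1) = s / (s + 1) by field_simp; ring]; positivity), ← e]
  have h₂ := mul_le_mul_of_nonneg_left h (Real.rpow_nonneg hpos.le (1 - α))
  rw [← e₂] at h₂
  have e₃ : ((s : ℝ) + 1) ^ (-α) = ((s : ℝ) + 1) ^ (1 - α) / (s + 1) := by
    rw [← Real.rpow_sub_one hpos.ne']; congr 1; ring
  rw [aCoeff, e₃]
  have : ((s : ℝ) + 1) ^ (1 - α) * (1 + (1 - α) * (-1 / (s + 1))) =
    ((s : ℝ) + 1) ^ (1 - α) - (1 - α) * (((s : ℝ) + 1) ^ (1 - α) / (s + 1)) := by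
    field_simp; ring
  linarith

/-- Midpoint convexity of `x ^ (-γ)`, from AM-GM and `(x + t)(x - t) ≤ x²`. -/
theorem two_mul_rpow_neg_le {x t γ : ℝ} (ht : 0 ≤ t) (hx : t < x) (hγ : 0 ≤ γ) :
    2 * x ^ (-γ) ≤ (x + t) ^ (-γ) + (x - t) ^ (-γ) := by
  have h₁ : 0 < x + t := by linarith
  have h₂ : 0 < x - t := by linarith
  have h₃ : 0 < x := by linarith
  have hA := Real.rpow_pos_of_pos h₁ (-γ)
  have hB := Real.rpow_pos_of_pos h₂ (-γ)
  have hC := Real.rpow_pos_of_pos h₃ (-γ)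
  have hAB : x ^ (-γ) * x ^ (-γ) ≤ (x + t) ^ (-γ) * (x - t) ^ (-γ) := by
    rw [← Real.mul_rpow h₃.le h₃.le, ← Real.mul_rpow h₁.le h₂.le]
    exact Real.rpow_le_rpow_of_nonpos (mul_pos h₁ h₂) (by nlinarith) (by linarith)
  refine le_of_sq_le_sq ?_ (by positivity)
  nlinarith [sq_nonneg ((x + t) ^ (-γ) - (x - t) ^ (-γ))]

/-- The difference is minus the second difference of `x ^ (1 - α)` at `s + 1`, hence an integral of
`(x+t) ^ (-α-1) + (x-t) ^ (-α-1)` against `α (1 - α) (1 - t)`, to which midpoint convexity applies.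
-/
theorem le_aCoeff_sub {α : ℝ} (hα0 : 0 < α) (hα1 : α < 1) {s : ℕ} (hs : 1 ≤ s) :
    α * (1 - α) * ((s : ℝ) + 1) ^ (-α - 1) ≤ aCoeff α s - aCoeff α (s + 1) := by
  have hs' : (1 : ℝ) ≤ s := by exact_mod_cast hs
  set x : ℝ := (s : ℝ) + 1 with hx
  -- `Q` is an antiderivative of that integrand minus its lower bound, so `Q 0 ≤ Q 1` is the claim.
  set Q : ℝ → ℝ := fun t => (1 - t) * ((1 - α) * ((x - t) ^ (-α) - (x + t) ^ (-α)))
    - (x + t) ^ (1 - α) - (x - t) ^ (1 - α) - α * (1 - α) * x ^ (-α - 1) * (2 * t - t ^ 2) with hQ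
  have hd : ∀ t ∈ Icc (0 : ℝ) 1, HasDerivAt Q ((1 - t) * (α * (1 - α)) *
      ((x + t) ^ (-α - 1) + (x - t) ^ (-α - 1) - 2 * x ^ (-α - 1))) t := by
    intro t ht
    have hd₁ : ∀ p : ℝ, HasDerivAt (fun t : ℝ => (x + t) ^ p) (p * (x + t) ^ (p - 1)) t :=
      fun p => by
        have := ((hasDerivAt_id t).const_add x).rpow_const (p := p)
          (Or.inl (by simp only [id]; linarith [ht.1]))
        simpa using this
    have hd₂ : ∀ p : ℝ, HasDerivAt (fun t : ℝ => (x - t) ^ p) (-(p * (x - t) ^ (p - 1))) t :=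
      fun p => by
        have := ((hasDerivAt_id t).const_sub x).rpow_const (p := p)
          (Or.inl (by simp only [id]; linarith [ht.2]))
        simpa using this
    have hd₃ : HasDerivAt (fun t : ℝ => 2 * t - t ^ 2) (2 - 2 * t) t := by
      have := ((hasDerivAt_id t).const_mul 2).sub (hasDerivAt_pow 2 t)
      exact this.congr_deriv (by norm_num)
    have := (((((hasDerivAt_id t).const_sub 1).mul (((hd₂ (-α)).sub (hd₁ (-α))).const_mul
      (1 - α))).sub (hd₁ (1 - α))).sub (hd₂ (1 - α))).sub
      (hd₃.const_mul (α * (1 - α) * x ^ (-α - 1)))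
    refine this.congr_deriv ?_
    have e₂ : (1 - α - 1) = -α := by ring
    rw [e₂]
    simp only [id, Pi.sub_apply]
    ring
  have hmono : MonotoneOn Q (Icc 0 1) := by
    refine monotoneOn_of_hasDerivWithinAt_nonneg (convex_Icc 0 1)
      (fun t ht => (hd t ht).continuousAt.continuousWithinAt)
      (fun t ht => (hd t (interior_subset ht)).hasDerivWithinAt) fun t ht => ?_
    have ht' : t ∈ Icc (0 : ℝ) 1 := interior_subset ht
    have := two_mul_rpow_neg_le (x := x) (t := t) (γ := α + 1) ht'.1 (by linarith [ht'.2])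
      (by linarith)
    rw [show -(α + 1) = -α - 1 by ring] at this
    exact mul_nonneg (mul_nonneg (by linarith [ht'.2]) (by nlinarith)) (by linarith)
  have h := hmono (left_mem_Icc.2 zero_le_one) (right_mem_Icc.2 zero_le_one) zero_le_one
  have e₁ : x - 1 = s := by rw [hx]; ring
  simp only [hQ, e₁] at h
  norm_num at h
  rw [aCoeff, aCoeff]
  push_cast
  rw [← hx]
  linarith

theorem aCoeff_succ_le {α : ℝ} (hα0 : 0 < α) (hα1 : α < 1) {s : ℕ} (hs : 1 ≤ s) :
    aCoeff α (s + 1) ≤ aCoeff α s := by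
  have h := le_aCoeff_sub hα0 hα1 hs
  have : 0 ≤ α * (1 - α) * ((s : ℝ) + 1) ^ (-α - 1) :=
    mul_nonneg (by nlinarith) (by positivity)
  linarith

theorem bCoeff_add_bCoeff_le {α : ℝ} (hα0 : 0 < α) (hα1 : α < 1) {s : ℕ} (hs : 1 ≤ s) :
    bCoeff α (s + 1) + bCoeff α s ≤ aCoeff α (s + 1) := by
  have hs' : (1 : ℝ) ≤ s := by exact_mod_cast hs
  have hs0 : (0 : ℝ) < s := by linarith
  have h₁ := bCoeff_succ_le hα0 hα1 hs
  have h₂ := bCoeff_le hα0 hα1 hs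
  have h₃ := le_aCoeff hα0 hα1 (s + 1)
  push_cast at h₃
  -- The factor 3 comes from `s + 2 ≤ 3 s` and `3 ^ (-α) ≥ 1/3`.
  have h₄ : (s : ℝ) ^ (-α - 1) ≤ 3 * ((s : ℝ) + 1 + 1) ^ (-α) := by
    have e₁ : (s : ℝ) ^ (-α - 1) ≤ (s : ℝ) ^ (-α) :=
      Real.rpow_le_rpow_of_exponent_le hs' (by linarith)
    have e₂ : (3 * (s : ℝ)) ^ (-α) ≤ ((s : ℝ) + 1 + 1) ^ (-α) :=
      Real.rpow_le_rpow_of_nonpos (by linarith) (by linarith) (by linarith)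
    rw [Real.mul_rpow (by norm_num) hs0.le] at e₂
    have e₃ : (3 : ℝ) ^ (-1 : ℝ) ≤ 3 ^ (-α) :=
      Real.rpow_le_rpow_of_exponent_le (by norm_num) (by linarith)
    rw [Real.rpow_neg_one] at e₃
    have e₄ := mul_le_mul_of_nonneg_right e₃ (Real.rpow_nonneg hs0.le (-α))
    linarith
  have hp : 0 ≤ ((s : ℝ) + 1 + 1) ^ (-α) := by positivity
  have hαα : 0 ≤ α * (1 - α) := by nlinarith
  have h₅ := mul_le_mul_of_nonneg_left h₄ hαα
  have h₆ : α * (1 - α) * ((s : ℝ) + 1 + 1) ^ (-α) ≤ (1 - α) * ((s : ℝ) + 1 + 1) ^ (-α) :=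
    mul_le_mul_of_nonneg_right (by nlinarith) hp
  have h₇ := mul_nonneg hαα hp
  linarith

theorem bCoeff_one_le {α : ℝ} (hα0 : 0 < α) (hα1 : α < 1) : bCoeff α 1 ≤ aCoeff α 1 := by
  have h₂ := bCoeff_le hα0 hα1 le_rfl
  have h₃ := le_aCoeff hα0 hα1 1
  push_cast at h₂ h₃
  rw [Real.one_rpow] at h₂
  have e₃ : (2 : ℝ) ^ (-1 : ℝ) ≤ 2 ^ (-α) :=
    Real.rpow_le_rpow_of_exponent_le (by norm_num) (by linarith)
  rw [Real.rpow_neg_one] at e₃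
  norm_num at h₃
  nlinarith

theorem bCoeff_le_aCoeff {α : ℝ} (hα0 : 0 < α) (hα1 : α < 1) (s : ℕ) :
    bCoeff α s ≤ aCoeff α s := by
  rcases s with _ | _ | s
  · rw [bCoeff_zero hα1, aCoeff_zero hα1]
    have : 1 / (2 - α) ≤ 1 := by rw [div_le_one] <;> linarith
    linarith
  · exact bCoeff_one_le hα0 hα1
  · have := bCoeff_add_bCoeff_le hα0 hα1 (s := s + 1) (by omega)
    have := bCoeff_nonneg hα0 hα1 (s + 1)
    linarith

/-! ### Splitting of the L2 coefficients into a BDF2 part and a decreasing part -/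

/-- The part of the L2 coefficients which remains after subtraction of the multiple `b₀` of the
second order backward difference and of the correction on the first time interval. -/
def mCoeff (α : ℝ) : ℕ → ℝ
  | 0 => 1 - 2 * bCoeff α 0
  | 1 => aCoeff α 1 + bCoeff α 1
  | s + 2 => aCoeff α (s + 2) + bCoeff α (s + 2) - bCoeff α (s + 1)

/-- Mere monotonicity is not enough: the correction adds `b_j` to the coefficient with index `j -
1`, so the drop from index `j - 2` must leave room for it. The room exists because `a_s - a_{s+1}`
and `b_s` both decay like `s ^ (-α - 1)`, with the factor `1/12` in the bound for `b_s`. -/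
theorem mCoeff_succ_add_le {α : ℝ} (hα0 : 0 < α) (hα1 : α < 1) (s : ℕ) :
    mCoeff α (s + 1) + bCoeff α (s + 2) ≤ mCoeff α s := by
  rcases s with _ | _ | s
  · simp only [mCoeff, zero_add]
    have h₁ := bCoeff_le hα0 hα1 le_rfl
    have h₂ := bCoeff_le hα0 hα1 (by norm_num : 1 ≤ 2)
    push_cast at h₁ h₂
    rw [Real.one_rpow] at h₁
    have e₃ : (2 : ℝ) ^ (-α - 1) ≤ 2 ^ (-1 : ℝ) :=
      Real.rpow_le_rpow_of_exponent_le (by norm_num) (by linarith)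
    rw [Real.rpow_neg_one] at e₃
    have e₄ : aCoeff α 1 ≤ 1 - α := by
      have := rpow_one_add_le_one_add_mul_self (s := 1) (p := 1 - α) (by norm_num)
        (by linarith) (by linarith)
      rw [aCoeff]
      push_cast
      rw [Real.one_rpow]
      linarith
    have hαα : 0 ≤ α * (1 - α) := by nlinarith
    have h₃ := mul_le_mul_of_nonneg_left e₃ hαα
    rw [bCoeff_zero hα1]
    have e₅ : 1 - 2 * (1 / (2 - α) - 1 / 2) = 2 * (1 - α) / (2 - α) := by
      have : 2 - α ≠ 0 := by linarith
      field_simp; ring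
    rw [e₅]
    -- Here `α / 8 = α / 12 + α / 24`, the bounds for `b_1` and `b_2` divided by `1 - α`.
    have e₆ : (1 - α) * (1 + α / 8) ≤ 2 * (1 - α) / (2 - α) := by
      rw [le_div_iff₀ (by linarith)]
      have : 0 ≤ (1 - α) * α * (6 + α) := mul_nonneg (by nlinarith) (by linarith)
      nlinarith
    linarith
  · simp only [mCoeff, zero_add]
    have h₁ := aCoeff_succ_le hα0 hα1 (le_refl 1)
    have h₂ := bCoeff_succ_le hα0 hα1 (le_refl 1)
    have h₃ := bCoeff_succ_le hα0 hα1 (by norm_num : 1 ≤ 2)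
    norm_num at h₁ h₂ h₃ ⊢
    linarith
  · simp only [mCoeff]
    have h₁ := le_aCoeff_sub hα0 hα1 (by omega : 1 ≤ s + 2)
    have h₂ := bCoeff_succ_le hα0 hα1 (by omega : 1 ≤ s + 2)
    have h₃ := bCoeff_succ_le hα0 hα1 (by omega : 1 ≤ s + 3)
    have h₄ := bCoeff_le hα0 hα1 (by omega : 1 ≤ s + 1)
    -- From `s + 3 ≤ 3 (s + 1)` and exponent at least `-2`; the factor 9 stays below the 12 in
    -- `bCoeff_le`.
    have e : ((s + 1 : ℕ) : ℝ) ^ (-α - 1) ≤ 9 * (((s + 2 : ℕ) : ℝ) + 1) ^ (-α - 1) := by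
      have hs : (0 : ℝ) ≤ s := Nat.cast_nonneg s
      have e₂ : (3 * ((s + 1 : ℕ) : ℝ)) ^ (-α - 1) ≤ (((s + 2 : ℕ) : ℝ) + 1) ^ (-α - 1) :=
        Real.rpow_le_rpow_of_nonpos (by positivity) (by push_cast; linarith) (by linarith)
      rw [Real.mul_rpow (by norm_num) (by positivity)] at e₂
      have e₃ : (3 : ℝ) ^ (-2 : ℝ) ≤ 3 ^ (-α - 1) :=
        Real.rpow_le_rpow_of_exponent_le (by norm_num) (by linarith)
      rw [Real.rpow_neg (by norm_num)] at e₃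
      norm_num at e₃
      have e₄ := mul_le_mul_of_nonneg_right e₃
        (Real.rpow_nonneg (Nat.cast_nonneg (s + 1) : (0 : ℝ) ≤ (s + 1 : ℕ)) (-α - 1))
      linarith
    have hαα : 0 ≤ α * (1 - α) := by nlinarith
    have h₅ := mul_le_mul_of_nonneg_left e hαα
    have h₆ : 0 ≤ α * (1 - α) * (((s + 2 : ℕ) : ℝ) + 1) ^ (-α - 1) :=
      mul_nonneg hαα (by positivity)
    simp only [add_assoc, Nat.reduceAdd] at *
    linarith

theorem mCoeff_succ_le {α : ℝ} (hα0 : 0 < α) (hα1 : α < 1) (s : ℕ) :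
    mCoeff α (s + 1) ≤ mCoeff α s := by
  have := mCoeff_succ_add_le hα0 hα1 s
  have := bCoeff_nonneg hα0 hα1 (s + 2)
  linarith

theorem two_mul_bCoeff_le_mCoeff {α : ℝ} (hα0 : 0 < α) (hα1 : α < 1) {j : ℕ} (hj : 1 ≤ j) :
    2 * bCoeff α j ≤ mCoeff α j := by
  rcases j with _ | _ | j
  · omega
  · have := bCoeff_one_le hα0 hα1
    simp only [mCoeff, zero_add]
    linarith
  · have := bCoeff_add_bCoeff_le hα0 hα1 (by omega : 1 ≤ j + 1)
    simp only [mCoeff]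
    simp only [add_assoc, Nat.reduceAdd] at *
    linarith

theorem mCoeff_nonneg {α : ℝ} (hα0 : 0 < α) (hα1 : α < 1) (j : ℕ) : 0 ≤ mCoeff α j := by
  have h := two_mul_bCoeff_le_mCoeff hα0 hα1 (by omega : 1 ≤ j + 1)
  have := mCoeff_succ_le hα0 hα1 j
  have := bCoeff_nonneg hα0 hα1 (j + 1)
  linarith

/-- The coefficients `mCoeff` together with the correction on the first time interval. -/
def mCorr (α : ℝ) (j s : ℕ) : ℝ :=
  mCoeff α s + (if s + 1 = j then bCoeff α j else 0) - (if s = j then 2 * bCoeff α j else 0)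

/-- The weights `3` and `-1` on the two latest increments form the BDF2 stencil. In this form the
exceptional formulas for `j = 1` and for `s = j - 1`, `s = j` become one correction. -/
theorem cCoeff_eq {α : ℝ} (hα1 : α < 1) {j s : ℕ} (hj : 1 ≤ j) (hs : s ≤ j) :
    cCoeff α j s = mCorr α j s + (if s = 0 then 3 * bCoeff α 0 else 0) -
      (if s = 1 then bCoeff α 0 else 0) := by
  have h₀ := aCoeff_zero hα1
  obtain rfl | hj := hj.eq_or_lt
  · interval_cases s <;> simp [cCoeff, mCorr, mCoeff, h₀] <;> ring
  · have n₁ : ¬ j = 1 := by omega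
    have n₂ : ¬ 1 = j := by omega
    rcases s with _ | _ | s
    · have n₃ : ¬ 0 = j := by omega
      simp [cCoeff, mCorr, mCoeff, h₀, n₁, n₂, n₃]
      ring
    · obtain rfl | hj := (Nat.succ_le_of_lt hj).eq_or_lt
      · simp [cCoeff, mCorr, mCoeff]
      · have n₃ : ¬ 2 = j := by omega
        have n₄ : ¬ 1 = j - 1 := by omega
        simp [cCoeff, mCorr, mCoeff, n₁, n₂, n₃, n₄]
    · by_cases h₁ : s + 2 = j
      · subst h₁
        simp [cCoeff, mCorr, mCoeff]; ring
      · by_cases h₂ : s + 3 = j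
        · subst h₂
          simp [cCoeff, mCorr, mCoeff]; ring
        · have n₃ : ¬ s + 1 + 1 = j - 1 := by omega
          have n₄ : ¬ s + 1 + 1 = j := h₁
          have n₅ : ¬ s + 1 + 1 + 1 = j := h₂
          simp [cCoeff, mCorr, mCoeff, n₁, n₃, n₄, n₅]

theorem mCorr_succ_le {α : ℝ} (hα0 : 0 < α) (hα1 : α < 1) {j s : ℕ} (hs : s < j) :
    mCorr α j (s + 1) ≤ mCorr α j s := by
  have h₁ := mCoeff_succ_add_le hα0 hα1 s
  have h₂ := bCoeff_nonneg hα0 hα1 (s + 2)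
  have h₃ := bCoeff_nonneg hα0 hα1 j
  unfold mCorr
  rw [if_neg hs.ne]
  by_cases h₄ : s + 2 = j
  · subst h₄
    simp; linarith
  · rw [if_neg (by omega : ¬ s + 1 + 1 = j)]
    split_ifs <;> linarith

open Finset in
theorem sum_cCoeff_mul {α : ℝ} (hα1 : α < 1) {j : ℕ} (hj : 1 ≤ j) (d : ℕ → ℝ) :
    ∑ s ∈ range (j + 1), cCoeff α j s * d s =
      ∑ s ∈ range (j + 1), mCorr α j s * d s + bCoeff α 0 * (3 * d 0 - d 1) := by
  rw [sum_congr rfl fun s hs => by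
    rw [cCoeff_eq hα1 hj (by simpa [Nat.lt_succ_iff] using hs), sub_mul, add_mul]]
  simp only [sum_sub_distrib, sum_add_distrib, ite_mul, zero_mul]
  rw [sum_ite_eq_of_mem' _ _ _ (by simp), sum_ite_eq_of_mem' _ _ _ (by simp; omega)]
  ring

open Finset in
theorem sum_mCorr_mul (α : ℝ) {j : ℕ} (hj : 1 ≤ j) (d : ℕ → ℝ) :
    ∑ s ∈ range (j + 1), mCorr α j s * d s =
      ∑ s ∈ range (j + 1), mCoeff α s * d s + bCoeff α j * (d (j - 1) - 2 * d j) := by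
  obtain ⟨i, rfl⟩ : ∃ i, j = i + 1 := ⟨j - 1, by omega⟩
  simp only [mCorr, sub_mul, add_mul, sum_sub_distrib, sum_add_distrib, ite_mul, zero_mul,
    add_left_inj]
  rw [sum_ite_eq_of_mem' _ _ _ (by simp), sum_ite_eq_of_mem' _ _ _ (by simp)]
  simp only [Nat.add_sub_cancel]
  ring

/-! ### Energy estimate in time -/

open Finset in
/-- The discrete energy of a sequence at the level `j`. -/
def energy (α : ℝ) (w : ℕ → ℝ) (j : ℕ) : ℝ :=
  bCoeff α 0 * (w j ^ 2 + (2 * w j - w (j - 1)) ^ 2) +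
    ∑ s ∈ range j, mCoeff α s * w (j - s) ^ 2

theorem energy_nonneg {α : ℝ} (hα0 : 0 < α) (hα1 : α < 1) (w : ℕ → ℝ) (j : ℕ) :
    0 ≤ energy α w j :=
  add_nonneg (mul_nonneg (bCoeff_nonneg hα0 hα1 0) (by positivity))
    (Finset.sum_nonneg fun s _ => mul_nonneg (mCoeff_nonneg hα0 hα1 s) (sq_nonneg _))

open Finset in
theorem energy_step {α : ℝ} (hα0 : 0 < α) (hα1 : α < 1) {j : ℕ} (hj : 1 ≤ j) (w : ℕ → ℝ)
    (hw : w 0 = 0) :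
    energy α w (j + 1) - energy α w j - 3 * bCoeff α j * w 1 ^ 2 ≤
      2 * (w (j + 1) * ∑ s ∈ range (j + 1), cCoeff α j s * (w (j + 1 - s) - w (j - s))) := by
  have hb := bCoeff_nonneg hα0 hα1 j
  have hb₀ := bCoeff_nonneg hα0 hα1 0
  have h := sum_mul_sq_sub_sq_le (mCorr α j) w j (fun s hs => mCorr_succ_le hα0 hα1 hs) (by
    have := two_mul_bCoeff_le_mCoeff hα0 hα1 hj
    simp only [mCorr]
    simp; linarith)
  rw [sum_mCorr_mul α hj fun s => w (j + 1 - s) ^ 2 - w (j - s) ^ 2] at h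
  rw [sum_cCoeff_mul hα1 hj fun s => w (j + 1 - s) - w (j - s)]
  obtain ⟨i, rfl⟩ : ∃ i, j = i + 1 := ⟨j - 1, by omega⟩
  have e : ∑ s ∈ range (i + 1 + 1), mCoeff α s * (w (i + 1 + 1 - s) ^ 2 - w (i + 1 - s) ^ 2) =
      ∑ s ∈ range (i + 1 + 1), mCoeff α s * w (i + 1 + 1 - s) ^ 2 -
      ∑ s ∈ range (i + 1), mCoeff α s * w (i + 1 - s) ^ 2 := by
    simp only [mul_sub, sum_sub_distrib]
    rw [sum_range_succ (fun s => mCoeff α s * w (i + 1 - s) ^ 2)]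
    simp [hw]
  rw [e] at h
  simp only [Nat.add_sub_cancel, Nat.sub_self, hw, Nat.sub_zero,
    (by omega : i + 1 + 1 - i = 2), (by omega : i + 1 - i = 1),
    (by omega : i + 1 + 1 - (i + 1) = 1)] at h ⊢
  simp only [energy, Nat.add_sub_cancel]
  -- The square left over in the BDF2 identity `2a(3a - 4b + c) = a² + (2a - b)² - b² - (2b - c)² +
  -- (a - 2b + c)²`.
  have h₂ : 0 ≤ bCoeff α 0 * (w (i + 1 + 1) - 2 * w (i + 1) + w i) ^ 2 :=
    mul_nonneg hb₀ (sq_nonneg _)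
  -- On squares the first-interval correction is `b_j (w 2 ^ 2 - 3 * w 1 ^ 2)`; the first term is
  -- dropped, the second is the loss in the statement.
  have h₃ : 0 ≤ bCoeff α (i + 1) * w 2 ^ 2 := mul_nonneg hb (sq_nonneg _)
  nlinarith

open Finset in
/-- Positivity of the L2 formula, up to the value of the sequence on the first layer. -/
theorem le_sum_mul_l2 {α : ℝ} (hα0 : 0 < α) (hα1 : α < 1) {M : ℕ} (hM : 1 ≤ M) (w : ℕ → ℝ)
    (hw : w 0 = 0) :
    -(3 * (M : ℝ) ^ (1 - α) * w 1 ^ 2) ≤ ∑ j ∈ Finset.Ico 1 M,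
      w (j + 1) * ∑ s ∈ range (j + 1), cCoeff α j (j - s) * (w (s + 1) - w s) := by
  have h₁ : ∀ j ∈ Finset.Ico 1 M, energy α w (j + 1) - energy α w j - 3 * bCoeff α j * w 1 ^ 2 ≤
      2 * (w (j + 1) * ∑ s ∈ range (j + 1), cCoeff α j (j - s) * (w (s + 1) - w s)) := by
    intro j hj
    refine (energy_step hα0 hα1 (Finset.mem_Ico.1 hj).1 w hw).trans_eq ?_
    rw [← sum_range_reflect]
    congr 2
    refine sum_congr rfl fun s hs => ?_
    have : s < j + 1 := mem_range.1 hs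
    rw [show j + 1 - 1 - s = j - s by omega, show j + 1 - (j - s) = s + 1 by omega,
      show j - (j - s) = s by omega]
  have h₂ := sum_le_sum h₁
  rw [sum_sub_distrib, Finset.sum_Ico_sub _ hM, ← mul_sum] at h₂
  -- The crude `b_j ≤ a_j` suffices, since the `a_j` telescope; the factor `τ ^ (1 - α)` of the L2
  -- formula later turns `M ^ (1 - α)` into `T ^ (1 - α)`.
  have h₃ : ∑ j ∈ Finset.Ico 1 M, 3 * bCoeff α j * w 1 ^ 2 ≤ 3 * (M : ℝ) ^ (1 - α) * w 1 ^ 2 := by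
    rw [← sum_mul, ← mul_sum]
    refine mul_le_mul_of_nonneg_right (mul_le_mul_of_nonneg_left ?_ (by norm_num)) (sq_nonneg _)
    rw [← sum_aCoeff hα1]
    refine (sum_le_sum fun j _ => bCoeff_le_aCoeff hα0 hα1 j).trans ?_
    refine sum_le_sum_of_subset_of_nonneg (fun j hj => by simp at hj ⊢; omega) fun j _ _ => ?_
    exact (bCoeff_nonneg hα0 hα1 j).trans (bCoeff_le_aCoeff hα0 hα1 j)
  have h₄ : energy α w 1 ≤ 3 * (M : ℝ) ^ (1 - α) * w 1 ^ 2 := by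
    have hM' : (1 : ℝ) ≤ (M : ℝ) ^ (1 - α) :=
      Real.one_le_rpow (by exact_mod_cast hM) (by linarith)
    have hb : bCoeff α 0 ≤ 1 / 2 := by
      rw [bCoeff_zero hα1]
      have : 1 / (2 - α) ≤ 1 := by rw [div_le_one] <;> linarith
      linarith
    have e : energy α w 1 = (1 + 3 * bCoeff α 0) * w 1 ^ 2 := by
      simp [energy, hw, mCoeff]; ring
    rw [e]
    exact mul_le_mul_of_nonneg_right (by linarith) (sq_nonneg _)
  have h₅ := energy_nonneg hα0 hα1 w M
  linarith

/-! ### Smooth extension from an interval and Taylor's formula -/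

/-- Extend the top derivative by constants and integrate back `n` times. This replaces one-sided
derivatives by ordinary ones. -/
theorem exists_contDiff_eqOn {a b : ℝ} (hab : a < b) (n : ℕ) : ∀ v : ℝ → ℝ,
    ContDiffOn ℝ n v (Icc a b) → ∃ V : ℝ → ℝ, ContDiff ℝ n V ∧ EqOn V v (Icc a b) := by
  induction n with
  | zero =>
    intro v hv
    have hc : ContinuousOn v (Icc a b) := hv.continuousOn
    refine ⟨IccExtend hab.le ((Icc a b).domRestrict v), ?_, fun x hx => ?_⟩
    · rw [Nat.cast_zero, contDiff_zero]
      exact (continuousOn_iff_continuous_domRestrict.1 hc).Icc_extend'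
    · rw [IccExtend_of_mem _ _ hx]; rfl
  | succ n ih =>
    intro v hv
    have hu := uniqueDiffOn_Icc hab
    push_cast at hv
    obtain ⟨hd, -, hv'⟩ := (contDiffOn_succ_iff_derivWithin hu).1 hv
    obtain ⟨W, hW, hWv⟩ := ih _ hv'
    have hder : ∀ x, HasDerivAt (fun x => v a + ∫ t in a..x, W t) (W x) x := fun x =>
      (intervalIntegral.integral_hasDerivAt_right (hW.continuous.intervalIntegrable _ _)
        (hW.continuous.stronglyMeasurableAtFilter _ _) hW.continuous.continuousAt).const_add _
    refine ⟨fun x => v a + ∫ t in a..x, W t, ?_, ?_⟩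
    · push_cast
      rw [contDiff_succ_iff_deriv]
      refine ⟨fun x => (hder x).differentiableAt, by simp, ?_⟩
      rwa [funext fun x => (hder x).deriv]
    · refine eq_of_derivWithin_eq (fun x _ => (hder x).differentiableAt.differentiableWithinAt)
        hd (fun x hx => ?_) (by simp)
      rw [(hder x).hasDerivWithinAt.derivWithin (hu x (Ico_subset_Icc_self hx))]
      exact hWv (Ico_subset_Icc_self hx)

theorem iteratedDeriv_eq_iteratedDerivWithin {a b : ℝ} (hab : a < b) {n i : ℕ} (hi : i ≤ n)
    {V v : ℝ → ℝ} (hV : ContDiff ℝ n V) (hVv : EqOn V v (Icc a b)) {x : ℝ} (hx : x ∈ Icc a b) :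
    iteratedDeriv i V x = iteratedDerivWithin i v (Icc a b) x := by
  rw [← iteratedDerivWithin_congr hVv hx, iteratedDerivWithin_eq_iteratedDeriv
    (uniqueDiffOn_Icc hab) (hV.contDiffAt.of_le (by exact_mod_cast hi)) hx]

-- The derivative of the remainder is the remainder of `deriv V`, so the mean value inequality gives
-- an induction. The factor `1 / n!` is lost, which is harmless here.
open Finset in
theorem abs_sub_taylor_le (n : ℕ) : ∀ (V : ℝ → ℝ) (x K h : ℝ), ContDiff ℝ n V →
    (∀ y ∈ uIcc x (x + h), |iteratedDeriv n V y| ≤ K) →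
    |V (x + h) - ∑ i ∈ range n, iteratedDeriv i V x * h ^ i / i.factorial| ≤ K * |h| ^ n := by
  induction n with
  | zero =>
    intro V x K h _ hK
    simpa using hK (x + h) Set.right_mem_uIcc
  | succ n ih =>
    intro V x K h hV hK
    push_cast at hV
    have hV' := (contDiff_succ_iff_deriv.1 hV)
    set R : ℝ → ℝ := fun y =>
      V (x + y) - ∑ i ∈ range (n + 1), iteratedDeriv i V x * y ^ i / i.factorial with hR
    set R' : ℝ → ℝ := fun y =>
      deriv V (x + y) - ∑ i ∈ range n, iteratedDeriv i (deriv V) x * y ^ i / i.factorial with hR'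
    have hder : ∀ y, HasDerivAt R (R' y) y := by
      intro y
      have h₁ : HasDerivAt (fun y => V (x + y)) (deriv V (x + y)) y :=
        HasDerivAt.comp_const_add x y (hV'.1 (x + y)).hasDerivAt
      refine h₁.sub ?_
      simp only [sum_range_succ', pow_zero]
      have h₂ : HasDerivAt (fun y : ℝ => ∑ i ∈ range n,
          iteratedDeriv (i + 1) V x * y ^ (i + 1) / (i + 1).factorial)
          (∑ i ∈ range n, iteratedDeriv i (deriv V) x * y ^ i / i.factorial) y := by
        refine HasDerivAt.fun_sum fun i _ => ?_
        refine (((hasDerivAt_pow (i + 1) y).const_mul _).div_const _).congr_deriv ?_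
        rw [iteratedDeriv_succ', Nat.factorial_succ]
        push_cast
        have : (i.factorial : ℝ) ≠ 0 := by positivity
        have : (i : ℝ) + 1 ≠ 0 := by positivity
        field_simp
      exact h₂.add_const _
    have hsub : ∀ y ∈ uIcc 0 h, x + y ∈ uIcc x (x + h) := fun y hy => by
      rw [Set.mem_uIcc] at hy ⊢
      rcases hy with hy | hy
      · left; constructor <;> linarith [hy.1, hy.2]
      · right; constructor <;> linarith [hy.1, hy.2]
    have habs : ∀ y ∈ uIcc 0 h, |y| ≤ |h| := fun y hy => by
      have := Set.abs_sub_left_of_mem_uIcc hy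
      simpa using this
    have hK0 : 0 ≤ K := (abs_nonneg _).trans (hK x Set.left_mem_uIcc)
    have hb : ∀ y ∈ uIcc 0 h, ‖R' y‖ ≤ K * |h| ^ n := by
      intro y hy
      have := ih (deriv V) x K y hV'.2.2 (fun z hz => by
        rw [← iteratedDeriv_succ']
        exact hK z (Set.uIcc_subset_uIcc Set.left_mem_uIcc (hsub y hy) hz))
      exact this.trans (mul_le_mul_of_nonneg_left
        (pow_le_pow_left₀ (abs_nonneg _) (habs y hy) n) hK0)
    have := (convex_uIcc 0 h).norm_image_sub_le_of_norm_hasDerivWithin_le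
      (fun y _ => (hder y).hasDerivWithinAt) hb Set.left_mem_uIcc Set.right_mem_uIcc
    have hR0 : R 0 = 0 := by simp [hR, sum_range_succ']
    rw [hR0] at this
    simpa [hR, pow_succ, mul_assoc] using this

/-! ### Truncation error of the L2 formula -/

/-- The derivative of the quadratic interpolation polynomial on three equidistant nodes. -/
theorem abs_deriv_sub_interp_le {V : ℝ → ℝ} {c τ K η : ℝ} (hτ : 0 < τ) (hV : ContDiff ℝ 3 V)
    (hK : ∀ y ∈ Icc (c - τ) (c + τ), |iteratedDeriv 3 V y| ≤ K) (hη : |η - c| ≤ τ) :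
    |deriv V η - ((V (c + τ) - V (c - τ)) / (2 * τ) +
      (V (c + τ) - 2 * V c + V (c - τ)) / τ ^ 2 * (η - c))| ≤ 4 * K * τ ^ 2 := by
  have hη' := abs_le.1 hη
  have hsub : ∀ h : ℝ, |h| ≤ τ → ∀ y ∈ uIcc c (c + h), |iteratedDeriv 3 V y| ≤ K := by
    intro h hh y hy
    have hh := abs_le.1 hh
    refine hK y (Set.uIcc_subset_Icc ⟨by linarith, by linarith⟩ ⟨by linarith, by linarith⟩ hy)
  have hK0 : 0 ≤ K := (abs_nonneg _).trans (hK c ⟨by linarith, by linarith⟩)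
  have h₁ := abs_sub_taylor_le 3 V c K τ hV (hsub τ (abs_of_pos hτ).le)
  have h₂ := abs_sub_taylor_le 3 V c K (-τ) hV (hsub (-τ) (by rw [abs_neg, abs_of_pos hτ]))
  have hV' : ContDiff ℝ 2 (deriv V) :=
    (contDiff_succ_iff_deriv.1 (by norm_num; exact hV : ContDiff ℝ (2 + 1) V)).2.2
  have h₃ := abs_sub_taylor_le 2 (deriv V) c K (η - c) hV' (fun y hy => by
    rw [← iteratedDeriv_succ']
    exact hsub (η - c) hη y hy)
  have e₁ : iteratedDeriv 1 (deriv V) c = iteratedDeriv 2 V c := by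
    rw [iteratedDeriv_succ' (n := 1)]
  simp only [Finset.sum_range_succ, Finset.sum_range_zero, iteratedDeriv_zero, iteratedDeriv_one,
    abs_neg, abs_of_pos hτ, ← sub_eq_add_neg, add_sub_cancel, e₁] at h₁ h₂ h₃
  norm_num at h₁ h₂ h₃
  have h₄ : |η - c| ^ 2 ≤ τ ^ 2 := pow_le_pow_left₀ (abs_nonneg _) hη 2
  set A := V (c + τ) - (V c + deriv V c * τ + iteratedDeriv 2 V c * τ ^ 2 / 2) with hA
  set B := V (c - τ) - (V c + -(deriv V c * τ) + iteratedDeriv 2 V c * τ ^ 2 / 2) with hB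
  set C := deriv V η - (deriv V c + iteratedDeriv 2 V c * (η - c)) with hC
  -- The quadratic Taylor part is reproduced exactly, so only the three remainders survive; they
  -- contribute `1 + 1 + 2` times `K * τ ^ 2`.
  have e : deriv V η - ((V (c + τ) - V (c - τ)) / (2 * τ) +
      (V (c + τ) - 2 * V c + V (c - τ)) / τ ^ 2 * (η - c)) =
      C - (A - B) / (2 * τ) - (A + B) / τ ^ 2 * (η - c) := by
    rw [hA, hB, hC]
    field_simp
    ring
  have hA2 : |(A - B) / (2 * τ)| ≤ K * τ ^ 2 := by
    rw [abs_div, abs_of_pos (by linarith : 0 < 2 * τ), div_le_iff₀ (by linarith)]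
    have := abs_sub A B
    nlinarith
  have hA3 : |(A + B) / τ ^ 2 * (η - c)| ≤ 2 * K * τ ^ 2 := by
    rw [abs_mul, abs_div, abs_of_pos (by positivity : 0 < τ ^ 2)]
    have h₅ : |A + B| / τ ^ 2 ≤ 2 * K * τ := by
      rw [div_le_iff₀ (by positivity)]
      have := abs_add_le A B
      nlinarith
    have := mul_le_mul h₅ hη (abs_nonneg _) (by positivity)
    nlinarith
  have hC2 : |C| ≤ K * τ ^ 2 := by
    have : K * (η - c) ^ 2 ≤ K * τ ^ 2 := by
      rw [sq_abs] at h₄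
      exact mul_le_mul_of_nonneg_left h₄ hK0
    linarith
  rw [e]
  have := abs_sub (C - (A - B) / (2 * τ)) ((A + B) / τ ^ 2 * (η - c))
  have := abs_sub C ((A - B) / (2 * τ))
  linarith

theorem intervalIntegrable_sub_rpow {p : ℝ} (hp : -1 < p) (t a b : ℝ) :
    IntervalIntegrable (fun η => (t - η) ^ p) MeasureTheory.volume a b := by
  have := (intervalIntegral.intervalIntegrable_rpow' hp (a := t - a) (b := t - b)).comp_sub_left t
  simpa using this

theorem integral_sub_rpow {p : ℝ} (hp : -1 < p) (t a b : ℝ) :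
    ∫ η in a..b, (t - η) ^ p = ((t - a) ^ (p + 1) - (t - b) ^ (p + 1)) / (p + 1) := by
  rw [intervalIntegral.integral_comp_sub_left (fun x => x ^ p), integral_rpow (Or.inl hp)]

/-- This is where `a_r` and `b_r` come from: up to scaling they are the moments of the kernel
against `1` and the distance to the midpoint. -/
theorem integral_linear_mul_rpow {α : ℝ} (hα1 : α < 1) {a τ t : ℝ} (hτ : 0 < τ) {r : ℕ}
    (ht : t = a + τ + r * τ) (δ e : ℝ) :
    ∫ η in a..a + τ, (δ + e / τ * (η - (a + τ / 2))) * (t - η) ^ (-α) =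
      τ ^ (1 - α) / (1 - α) * (aCoeff α r * δ + bCoeff α r * e) := by
  have hr : (0 : ℝ) ≤ r := Nat.cast_nonneg r
  have e₀ : EqOn (fun η => (δ + e / τ * (η - (a + τ / 2))) * (t - η) ^ (-α))
      (fun η => (δ + e / τ * (t - (a + τ / 2))) * (t - η) ^ (-α) - e / τ * (t - η) ^ (1 + -α))
      (uIcc a (a + τ)) := by
    intro η hη
    rw [uIcc_of_le (by linarith)] at hη
    have : 0 ≤ t - η := by nlinarith [hη.2, mul_nonneg hr hτ.le]
    simp only
    rw [Real.rpow_one_add' this (by linarith)]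
    ring
  rw [intervalIntegral.integral_congr e₀, intervalIntegral.integral_sub
    ((intervalIntegrable_sub_rpow (by linarith) t _ _).const_mul _)
    ((intervalIntegrable_sub_rpow (by linarith) t _ _).const_mul _),
    intervalIntegral.integral_const_mul, intervalIntegral.integral_const_mul,
    integral_sub_rpow (by linarith), integral_sub_rpow (by linarith)]
  have e₁ : t - a = (r + 1) * τ := by rw [ht]; ring
  have e₂ : t - (a + τ) = r * τ := by rw [ht]; ring
  have e₃ : t - (a + τ / 2) = (r + 1 / 2) * τ := by rw [ht]; ring
  have e₄ : -α + 1 = 1 - α := by ring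
  have e₅ : 1 + -α + 1 = 1 + (1 - α) := by ring
  have e₆ : 2 - α = 1 + (1 - α) := by ring
  rw [aCoeff, bCoeff, e₁, e₂, e₃, e₄, e₅, e₆, Real.mul_rpow (by positivity) hτ.le,
    Real.mul_rpow (by positivity) hτ.le, Real.mul_rpow (by positivity) hτ.le,
    Real.mul_rpow (by positivity) hτ.le, Real.rpow_one_add' hr (by linarith),
    Real.rpow_one_add' (by positivity) (by linarith), Real.rpow_one_add' hτ.le (by linarith)]
  have h₁ : 1 - α ≠ 0 := by linarith
  have h₂ : 1 + (1 - α) ≠ 0 := by linarith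
  field_simp
  ring

-- Returns from the stability form of the coefficients to their origin: with `d` indexed backwards
-- in time, each interval contributes a slope with weight `a` and a second difference with weight
-- `b`. The earliest interval has no left neighbour and borrows the second difference of the next
-- one.
open Finset in
theorem sum_cCoeff_mul_eq {α : ℝ} (hα1 : α < 1) {j : ℕ} (hj : 1 ≤ j) (d : ℕ → ℝ) :
    ∑ s ∈ range (j + 1), cCoeff α j s * d s =
      ∑ s ∈ range (j + 1), aCoeff α s * d s + ∑ s ∈ range j, bCoeff α s * (d s - d (s + 1)) +
        bCoeff α j * (d (j - 1) - d j) := by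
  rw [sum_cCoeff_mul hα1 hj, sum_mCorr_mul α hj]
  have key : ∀ i : ℕ, ∑ s ∈ range (i + 2), mCoeff α s * d s + bCoeff α 0 * (3 * d 0 - d 1) =
      ∑ s ∈ range (i + 2), aCoeff α s * d s +
        ∑ s ∈ range (i + 1), bCoeff α s * (d s - d (s + 1)) + bCoeff α (i + 1) * d (i + 1) := by
    intro i
    induction i with
    | zero => simp [sum_range_succ, mCoeff, aCoeff_zero hα1]; ring
    | succ i ih =>
      have hm : mCoeff α (i + 2) = aCoeff α (i + 2) + bCoeff α (i + 2) - bCoeff α (i + 1) := rfl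
      rw [sum_range_succ (fun s => mCoeff α s * d s), hm,
        sum_range_succ (fun s => aCoeff α s * d s),
        sum_range_succ (fun s => bCoeff α s * (d s - d (s + 1)))]
      simp only [add_assoc, Nat.reduceAdd] at ih ⊢
      linarith
  obtain ⟨i, rfl⟩ : ∃ i, j = i + 1 := ⟨j - 1, by omega⟩
  have := key i
  simp only [Nat.add_sub_cancel, add_assoc, Nat.reduceAdd] at this ⊢
  linarith

/-- Weights in the bound of the truncation error of the L2 formula. -/
def truncWeight (α : ℝ) (r : ℕ) : ℝ :=
  if r = 0 then 1 / (1 - α) else (r : ℝ) ^ (-α) - ((r : ℝ) + 1) ^ (-α)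

theorem sum_truncWeight_le {α : ℝ} (n : ℕ) :
    ∑ r ∈ Finset.range (n + 1), truncWeight α r ≤ 1 / (1 - α) + 1 := by
  have h : ∑ r ∈ Finset.range (n + 1), truncWeight α r =
      1 / (1 - α) + 1 - ((n : ℝ) + 1) ^ (-α) := by
    induction n with
    | zero => simp [truncWeight]
    | succ n ih =>
      rw [Finset.sum_range_succ, ih, truncWeight, if_neg (by omega)]
      push_cast
      ring
  have : 0 ≤ ((n : ℝ) + 1) ^ (-α) := by positivity
  linarith

/-- For `r = 0` the kernel is singular and is integrated directly. For `r ≥ 1` the interpolation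
error vanishes at both ends, so its derivative `D` has mean zero and a constant may be subtracted
from the kernel; only the kernel's variation over the interval remains. The alternatives for `c`
place the middle node at the left or the right end. -/
theorem abs_local_error_le {α : ℝ} (hα0 : 0 < α) (hα1 : α < 1) {V : ℝ → ℝ} {a c τ t K : ℝ}
    (hτ : 0 < τ) (hV : ContDiff ℝ 3 V)
    (hK : ∀ y ∈ Icc (c - τ) (c + τ), |iteratedDeriv 3 V y| ≤ K) (hac : a = c ∨ a + τ = c) {r : ℕ}
    (ht : t = a + τ + r * τ) :
    |(∫ η in a..a + τ, deriv V η * (t - η) ^ (-α)) - τ ^ (1 - α) / (1 - α) *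
      (aCoeff α r * ((V (a + τ) - V a) / τ) +
        bCoeff α r * ((V (c + τ) - 2 * V c + V (c - τ)) / τ))| ≤
      4 * K * τ ^ (3 - α) * truncWeight α r := by
  have hr : (0 : ℝ) ≤ r := Nat.cast_nonneg r
  have hK0 : 0 ≤ K := (abs_nonneg _).trans (hK c ⟨by linarith, by linarith⟩)
  set δ := (V (a + τ) - V a) / τ with hδ
  set e := (V (c + τ) - 2 * V c + V (c - τ)) / τ with he
  set D : ℝ → ℝ := fun η => deriv V η - (δ + e / τ * (η - (a + τ / 2))) with hD
  have hV' : Continuous (deriv V) := hV.continuous_deriv (by norm_num)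
  have hDc : Continuous D := by fun_prop
  have hDb : ∀ η ∈ uIcc a (a + τ), |D η| ≤ 4 * K * τ ^ 2 := by
    intro η hη
    rw [uIcc_of_le (by linarith)] at hη
    have hη' : |η - c| ≤ τ := by
      rw [abs_le]
      rcases hac with rfl | rfl <;> constructor <;> linarith [hη.1, hη.2]
    refine le_trans (le_of_eq ?_) (abs_deriv_sub_interp_le hτ hV hK hη')
    congr 1
    simp only [hD, hδ, he]
    rcases hac with rfl | rfl
    · field_simp; ring
    · rw [add_sub_cancel_right]; field_simp; ring
  have hker := intervalIntegrable_sub_rpow (p := -α) (by linarith) t a (a + τ)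
  have hDk : IntervalIntegrable (fun η => D η * (t - η) ^ (-α)) MeasureTheory.volume a (a + τ) :=
    hker.continuousOn_mul hDc.continuousOn
  have hsplit : (∫ η in a..a + τ, deriv V η * (t - η) ^ (-α)) - τ ^ (1 - α) / (1 - α) *
      (aCoeff α r * δ + bCoeff α r * e) = ∫ η in a..a + τ, D η * (t - η) ^ (-α) := by
    rw [← integral_linear_mul_rpow hα1 hτ ht, ← intervalIntegral.integral_sub
      (hker.continuousOn_mul hV'.continuousOn)
      (hker.continuousOn_mul (Continuous.continuousOn (by fun_prop)))]
    simp only [hD, sub_mul]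
  rw [hsplit]
  have hpow : τ ^ 2 * τ ^ (1 - α) = τ ^ (3 - α) := by
    rw [← Real.rpow_natCast τ 2, ← Real.rpow_add hτ]; congr 1; push_cast; ring
  rcases Nat.eq_zero_or_pos r with rfl | hr'
  · have ht' : t = a + τ := by rw [ht]; simp
    have h₁ : |∫ η in a..a + τ, D η * (t - η) ^ (-α)| ≤
        ∫ η in a..a + τ, 4 * K * τ ^ 2 * (t - η) ^ (-α) := by
      rw [← Real.norm_eq_abs]
      refine intervalIntegral.norm_integral_le_of_norm_le (by linarith)
        (Filter.Eventually.of_forall fun η hη => ?_) (hker.const_mul _)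
      have hη' : η ∈ uIcc a (a + τ) := by
        rw [uIcc_of_le (by linarith)]; exact Ioc_subset_Icc_self hη
      have : 0 ≤ t - η := by linarith [hη.2]
      rw [norm_mul, Real.norm_eq_abs, Real.norm_eq_abs, abs_of_nonneg (Real.rpow_nonneg this _)]
      exact mul_le_mul_of_nonneg_right (hDb η hη') (Real.rpow_nonneg this _)
    rw [intervalIntegral.integral_const_mul, integral_sub_rpow (by linarith), ht'] at h₁
    rw [ht']
    refine h₁.trans_eq ?_
    rw [truncWeight, if_pos rfl, ← hpow, sub_self, Real.zero_rpow (by linarith),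
      add_sub_cancel_left, show -α + 1 = 1 - α by ring]
    ring
  · have hr1 : (1 : ℝ) ≤ r := by exact_mod_cast hr'
    have hD0 : ∫ η in a..a + τ, D η = 0 := by
      simp only [hD]
      rw [intervalIntegral.integral_sub (hV'.intervalIntegrable _ _)
        (Continuous.intervalIntegrable (by fun_prop) _ _),
        intervalIntegral.integral_deriv_eq_sub (fun x _ => hV.differentiable (by norm_num) x)
          (hV'.intervalIntegrable _ _),
        intervalIntegral.integral_add (by simp)
          (Continuous.intervalIntegrable (by fun_prop) _ _),
        intervalIntegral.integral_const_mul, intervalIntegral.integral_sub (by simp) (by simp)]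
      simp [hδ]
      field_simp
      ring
    have h₁ : ∫ η in a..a + τ, D η * (t - η) ^ (-α) =
        ∫ η in a..a + τ, D η * ((t - η) ^ (-α) - (t - a) ^ (-α)) := by
      simp only [mul_sub]
      rw [intervalIntegral.integral_sub hDk
        ((hDc.intervalIntegrable _ _).mul_const _), intervalIntegral.integral_mul_const, hD0]
      simp
    have ha : t - a = (r + 1) * τ := by rw [ht]; ring
    have hb : t - (a + τ) = r * τ := by rw [ht]; ring
    have h₂ : ∀ η ∈ uIoc a (a + τ), ‖D η * ((t - η) ^ (-α) - (t - a) ^ (-α))‖ ≤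
        4 * K * τ ^ 2 * ((r * τ) ^ (-α) - ((r + 1) * τ) ^ (-α)) := by
      intro η hη
      have hη' : η ∈ uIcc a (a + τ) := uIoc_subset_uIcc hη
      rw [uIoc_of_le (by linarith)] at hη
      have hp : 0 < r * τ := by positivity
      have h₃ : (t - η) ^ (-α) ≤ (r * τ) ^ (-α) :=
        Real.rpow_le_rpow_of_nonpos hp (by rw [← hb]; linarith [hη.2]) (by linarith)
      have h₄ : ((r + 1) * τ) ^ (-α) ≤ (t - η) ^ (-α) :=
        Real.rpow_le_rpow_of_nonpos (by linarith [hη.2]) (by rw [← ha]; linarith [hη.1])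
          (by linarith)
      rw [norm_mul, Real.norm_eq_abs, Real.norm_eq_abs, ha, abs_of_nonneg (sub_nonneg.2 h₄)]
      exact mul_le_mul (hDb η hη') (by linarith) (sub_nonneg.2 h₄) (by positivity)
    have h₃ := intervalIntegral.norm_integral_le_of_norm_le_const h₂
    rw [h₁, ← Real.norm_eq_abs]
    refine h₃.trans_eq ?_
    rw [truncWeight, if_neg (by omega), ← hpow, add_sub_cancel_left, abs_of_pos hτ,
      Real.mul_rpow hr hτ.le, Real.mul_rpow (by positivity) hτ.le,
      show (1 - α) = 1 + -α by ring, Real.rpow_one_add' hτ.le (by linarith)]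
    ring

/-- The constant in the truncation error of the L2 formula. -/
def truncConst (α : ℝ) : ℝ := 4 * (1 / (1 - α) + 1) / Real.Gamma (1 - α)

open Finset in
theorem abs_l2Formula_sub_caputo_le_of_contDiff {α : ℝ} (hα0 : 0 < α) (hα1 : α < 1) {V : ℝ → ℝ}
    {τ K : ℝ} {j : ℕ} (hτ : 0 < τ) (hj : 1 ≤ j) (hV : ContDiff ℝ 3 V)
    (hK : ∀ y ∈ Set.Icc 0 ((j + 1 : ℕ) * τ), |iteratedDeriv 3 V y| ≤ K) :
    |l2Formula α τ (fun s => V (s * τ)) j - caputo α V ((j + 1 : ℕ) * τ)| ≤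
      truncConst α * K * τ ^ (3 - α) := by
  have hK0 : 0 ≤ K := (abs_nonneg _).trans (hK 0 ⟨le_rfl, by positivity⟩)
  set t : ℝ := (j + 1 : ℕ) * τ with ht
  have hV' : Continuous (deriv V) := hV.continuous_deriv (by norm_num)
  have hΓ : 0 < Real.Gamma (1 - α) := Real.Gamma_pos_of_pos (by linarith)
  have hΓ2 : Real.Gamma (2 - α) = (1 - α) * Real.Gamma (1 - α) := by
    rw [show 2 - α = 1 - α + 1 by ring, Real.Gamma_add_one (by linarith)]
  set d : ℕ → ℝ := fun r => (V (t - r * τ) - V (t - (r + 1) * τ)) / τ with hd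
  -- The middle node is the left end of the interval, except for the interval starting at time `0`
  -- (`r = j`), where it is the right end.
  set E : ℕ → ℝ := fun r => if r < j then d r - d (r + 1) else d (j - 1) - d j with hE
  set I : ℕ → ℝ := fun r => ∫ η in t - (r + 1) * τ..t - (r + 1) * τ + τ,
    deriv V η * (t - η) ^ (-α) with hI
  have hcap : ∫ η in (0 : ℝ)..t, deriv V η * (t - η) ^ (-α) = ∑ r ∈ range (j + 1), I r := by
    have h := intervalIntegral.sum_integral_adjacent_intervals
      (μ := MeasureTheory.volume) (f := fun η => deriv V η * (t - η) ^ (-α))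
      (a := fun k : ℕ => t - k * τ) (n := j + 1) (fun k _ =>
        (intervalIntegrable_sub_rpow (by linarith) t _ _).continuousOn_mul hV'.continuousOn)
    have e₁ : t - ((j + 1 : ℕ) : ℝ) * τ = 0 := by rw [ht]; ring
    simp only [e₁, Nat.cast_zero, zero_mul, sub_zero] at h
    rw [intervalIntegral.integral_symm, ← h, ← sum_neg_distrib]
    refine sum_congr rfl fun r _ => ?_
    rw [← intervalIntegral.integral_symm]
    simp only [hI]
    congr 1
    · push_cast; ring
    · ring
  have hl2 : l2Formula α τ (fun s => V (s * τ)) j = τ ^ (1 - α) / Real.Gamma (2 - α) *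
      ∑ r ∈ range (j + 1), (aCoeff α r * d r + bCoeff α r * E r) := by
    have h₁ : ∑ s ∈ range (j + 1), cCoeff α j (j - s) *
        ((V ((s + 1 : ℕ) * τ) - V (s * τ)) / τ) = ∑ r ∈ range (j + 1), cCoeff α j r * d r := by
      rw [← sum_range_reflect]
      refine sum_congr rfl fun r hr => ?_
      have hr' : r ≤ j := by simpa [Nat.lt_succ_iff] using hr
      rw [show j - (j + 1 - 1 - r) = r by omega, show j + 1 - 1 - r = j - r by omega]
      simp only [hd, ht]
      congr 3
      · congr 1; push_cast [Nat.cast_sub hr']; ring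
      · congr 1; push_cast [Nat.cast_sub hr']; ring
    rw [l2Formula, h₁, sum_cCoeff_mul_eq hα1 hj, sum_add_distrib,
      sum_range_succ (fun r => bCoeff α r * E r)]
    congr 1
    rw [add_assoc]
    congr 2
    · refine sum_congr rfl fun r hr => ?_
      simp only [hE]
      rw [if_pos (mem_range.1 hr)]
    · simp [hE]
  have hloc : ∀ r ∈ range (j + 1), |I r - τ ^ (1 - α) / (1 - α) *
      (aCoeff α r * d r + bCoeff α r * E r)| ≤ 4 * K * τ ^ (3 - α) * truncWeight α r := by
    intro r hr
    have hr' : r ≤ j := by simpa [Nat.lt_succ_iff] using hr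
    have ht' : t = t - (r + 1) * τ + τ + r * τ := by ring
    have e₁ : t - (r + 1) * τ + τ = t - r * τ := by ring
    rcases hr'.lt_or_eq with hlt | rfl
    · have hlt' : (r : ℝ) + 1 ≤ j := by exact_mod_cast hlt
      have h := abs_local_error_le hα0 hα1 (c := t - (r + 1) * τ) (a := t - (r + 1) * τ) hτ hV
        (K := K) (fun y hy => hK y ⟨?_, ?_⟩) (Or.inl rfl) ht'
      · refine le_of_eq_of_le ?_ h
        simp only [hI, hE, hd, if_pos hlt, e₁]
        congr 4
        push_cast
        rw [show t - (r + 1) * τ - τ = t - (r + 1 + 1) * τ by ring]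
        ring
      · refine le_trans ?_ hy.1
        rw [ht]; push_cast; nlinarith
      · refine hy.2.trans ?_
        have : 0 ≤ r * τ := by positivity
        linarith
    · have ha : t - (r + 1) * τ = 0 := by rw [ht]; push_cast; ring
      have h := abs_local_error_le hα0 hα1 (c := t - r * τ) (a := t - (r + 1) * τ) hτ hV
        (K := K) (fun y hy => hK y ⟨?_, ?_⟩) (Or.inr e₁) ht'
      · refine le_of_eq_of_le ?_ h
        simp only [hI, hE, hd, lt_irrefl, if_false, e₁]
        congr 4
        rw [Nat.cast_sub hj]
        push_cast
        rw [show t - r * τ - τ = t - (r + 1) * τ by ring,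
          show t - r * τ + τ = t - (r - 1) * τ by ring,
          show t - (r - 1 + 1) * τ = t - r * τ by ring]
        ring
      · refine le_trans ?_ hy.1
        linarith
      · refine hy.2.trans ?_
        have : (1 : ℝ) ≤ r := by exact_mod_cast hj
        nlinarith
  have hsum : |∑ r ∈ range (j + 1), (I r - τ ^ (1 - α) / (1 - α) *
      (aCoeff α r * d r + bCoeff α r * E r))| ≤ 4 * K * τ ^ (3 - α) * (1 / (1 - α) + 1) := by
    refine (abs_sum_le_sum_abs _ _).trans ((sum_le_sum hloc).trans ?_)
    rw [← mul_sum]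
    exact mul_le_mul_of_nonneg_left (sum_truncWeight_le j) (by positivity)
  rw [sum_sub_distrib, ← mul_sum, ← hcap] at hsum
  have e : l2Formula α τ (fun s => V (s * τ)) j - caputo α V t =
      -(1 / Real.Gamma (1 - α) * ((∫ η in (0 : ℝ)..t, deriv V η * (t - η) ^ (-α)) -
        τ ^ (1 - α) / (1 - α) * ∑ r ∈ range (j + 1), (aCoeff α r * d r + bCoeff α r * E r))) := by
    rw [hl2, hΓ2, caputo]
    have : 1 - α ≠ 0 := by linarith
    field_simp
    ring
  rw [e, abs_neg, abs_mul, abs_of_pos (by positivity : 0 < 1 / Real.Gamma (1 - α))]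
  refine (mul_le_mul_of_nonneg_left hsum (by positivity)).trans_eq ?_
  rw [truncConst]
  ring

theorem caputo_congr {α T t : ℝ} {v V : ℝ → ℝ} (h : EqOn V v (Icc 0 T)) (ht : t ∈ Ioc 0 T) :
    caputo α v t = caputo α V t := by
  unfold caputo
  congr 1
  refine intervalIntegral.integral_congr_ae ?_
  -- If `t = T`, the two-sided derivatives may differ at `η = t`, but a single point does not affect
  -- the integral.
  have hne : ∀ᵐ η ∂MeasureTheory.volume, η ≠ t :=
    MeasureTheory.Measure.ae_ne MeasureTheory.volume t
  filter_upwards [hne] with η hη hη'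
  rw [uIoc_of_le ht.1.le] at hη'
  have hlt : η < t := lt_of_le_of_ne hη'.2 hη
  rw [Filter.EventuallyEq.deriv_eq (f := V) (f₁ := v)]
  filter_upwards [Ioo_mem_nhds hη'.1 (hlt.trans_le ht.2)] with x hx
  exact (h (Ioo_subset_Icc_self hx)).symm

/-- The truncation error of the L2 formula. -/
theorem abs_l2Formula_sub_caputo_le {α T : ℝ} (hα0 : 0 < α) (hα1 : α < 1) (hT : 0 < T)
    {v : ℝ → ℝ} {τ K : ℝ} {j : ℕ} (hτ : 0 < τ) (hj : 1 ≤ j) (hjT : (j + 1 : ℕ) * τ ≤ T)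
    (hv : ContDiffOn ℝ 3 v (Icc 0 T))
    (hK : ∀ y ∈ Icc 0 T, |iteratedDerivWithin 3 v (Icc 0 T) y| ≤ K) :
    |l2Formula α τ (fun s => v (s * τ)) j - caputo α v ((j + 1 : ℕ) * τ)| ≤
      truncConst α * K * τ ^ (3 - α) := by
  obtain ⟨V, hV, hVv⟩ := exists_contDiff_eqOn hT 3 v hv
  have h := abs_l2Formula_sub_caputo_le_of_contDiff hα0 hα1 (K := K) hτ hj hV fun y hy => by
    have hy' : y ∈ Icc 0 T := ⟨hy.1, hy.2.trans hjT⟩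
    rw [iteratedDeriv_eq_iteratedDerivWithin hT le_rfl hV hVv hy']
    exact hK y hy'
  rw [← caputo_congr hVv ⟨by positivity, hjT⟩] at h
  refine le_of_eq_of_le ?_ h
  congr 2
  unfold l2Formula
  congr 1
  refine Finset.sum_congr rfl fun s hs => ?_
  have hs' : s ≤ j := by simpa [Nat.lt_succ_iff] using hs
  have hmem : ∀ i : ℕ, i ≤ j + 1 → (i : ℝ) * τ ∈ Icc 0 T := fun i hi =>
    ⟨by positivity, le_trans (mul_le_mul_of_nonneg_right (by exact_mod_cast hi) hτ.le) hjT⟩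
  simp only
  rw [hVv (hmem s (by omega)), hVv (hmem (s + 1) (by omega))]

/-! ### Consistency of the compact spatial approximation -/

/-- The fourth order compact approximation of the second derivative. -/
theorem abs_avg_sub_secondDiff_le {V : ℝ → ℝ} {x h K : ℝ} (hh : 0 < h) (hV : ContDiff ℝ 6 V)
    (hK : ∀ y ∈ Icc (x - h) (x + h), |iteratedDeriv 6 V y| ≤ K) :
    |(iteratedDeriv 2 V (x + h) + 10 * iteratedDeriv 2 V x + iteratedDeriv 2 V (x - h)) / 12 -
      (V (x + h) - 2 * V x + V (x - h)) / h ^ 2| ≤ 3 * K * h ^ 4 := by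
  have hsub : ∀ z : ℝ, |z| ≤ h → ∀ y ∈ uIcc x (x + z), |iteratedDeriv 6 V y| ≤ K := by
    intro z hz y hy
    have hz := abs_le.1 hz
    refine hK y (Set.uIcc_subset_Icc ⟨by linarith, by linarith⟩ ⟨by linarith, by linarith⟩ hy)
  have hK0 : 0 ≤ K := (abs_nonneg _).trans (hK x ⟨by linarith, by linarith⟩)
  have hh' : |h| ≤ h := (abs_of_pos hh).le
  have hn' : |-h| ≤ h := by rw [abs_neg, abs_of_pos hh]
  have hV2 : ContDiff ℝ 4 (iteratedDeriv 2 V) := hV.iterate_deriv' 4 2 |> fun h => by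
    rwa [← iteratedDeriv_eq_iterate] at h
  have hit : ∀ i, iteratedDeriv i (iteratedDeriv 2 V) = iteratedDeriv (i + 2) V := fun i => by
    simp only [iteratedDeriv_eq_iterate, Function.iterate_add_apply]
  have h₁ := abs_sub_taylor_le 6 V x K h hV (hsub h hh')
  have h₂ := abs_sub_taylor_le 6 V x K (-h) hV (hsub (-h) hn')
  have h₃ := abs_sub_taylor_le 4 (iteratedDeriv 2 V) x K h hV2 (by
    rw [hit]; exact hsub h hh')
  have h₄ := abs_sub_taylor_le 4 (iteratedDeriv 2 V) x K (-h) hV2 (by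
    rw [hit]; exact hsub (-h) hn')
  simp only [Finset.sum_range_succ, Finset.sum_range_zero, hit, iteratedDeriv_zero, abs_neg,
    abs_of_pos hh, ← sub_eq_add_neg, Nat.factorial] at h₁ h₂ h₃ h₄
  rw [abs_le] at h₁ h₂ h₃ h₄ ⊢
  norm_num at h₁ h₂ h₃ h₄
  have e₁ : (iteratedDeriv 2 V (x + h) + 10 * iteratedDeriv 2 V x +
      iteratedDeriv 2 V (x - h)) / 12 - (V (x + h) - 2 * V x + V (x - h)) / h ^ 2 =
      (h ^ 2 * (iteratedDeriv 2 V (x + h) + 10 * iteratedDeriv 2 V x +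
      iteratedDeriv 2 V (x - h)) / 12 - (V (x + h) - 2 * V x + V (x - h))) / h ^ 2 := by
    field_simp
  have hh2 : 0 < h ^ 2 := by positivity
  rw [e₁, le_div_iff₀ hh2, div_le_iff₀ hh2]
  have a₁ := mul_le_mul_of_nonneg_left h₃.1 hh2.le
  have a₂ := mul_le_mul_of_nonneg_left h₃.2 hh2.le
  have a₃ := mul_le_mul_of_nonneg_left h₄.1 hh2.le
  have a₄ := mul_le_mul_of_nonneg_left h₄.2 hh2.le
  -- The Taylor polynomials cancel; the remainders add up to `(2 + 2/12) * K * h ^ 6`, rounded up to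
  -- `3`.
  have hp : 0 ≤ K * h ^ 6 := by positivity
  constructor <;> nlinarith

/-! ### Summation by parts and norm inequalities for grid functions -/

theorem avg_eq {h : ℝ} (hh : h ≠ 0) (v : ℕ → ℝ) (i : ℕ) :
    avg h v i = (v (i + 1) + 10 * v i + v (i - 1)) / 12 := by
  unfold avg secondDiff
  field_simp
  ring

open Finset in
theorem sum_second_mul (z : ℕ → ℝ) (n : ℕ) :
    ∑ i ∈ range n, (z (i + 2) - 2 * z (i + 1) + z i) * z (i + 1) =
      -∑ i ∈ range (n + 1), (z (i + 1) - z i) ^ 2 + (z (n + 1) - z n) * z (n + 1) -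
        (z 1 - z 0) * z 0 := by
  induction n with
  | zero => simp; ring
  | succ n ih => rw [sum_range_succ, ih, sum_range_succ _ (n + 1)]; ring

open Finset in
theorem sum_second_sq_le (z : ℕ → ℝ) (n : ℕ) :
    ∑ i ∈ range n, (z (i + 2) - 2 * z (i + 1) + z i) ^ 2 ≤
      4 * ∑ i ∈ range (n + 1), (z (i + 1) - z i) ^ 2 := by
  have h₁ : ∑ i ∈ range n, (z (i + 2) - 2 * z (i + 1) + z i) ^ 2 ≤
      ∑ i ∈ range n, (2 * (z (i + 1 + 1) - z (i + 1)) ^ 2 + 2 * (z (i + 1) - z i) ^ 2) :=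
    sum_le_sum fun i _ => by
      nlinarith [sq_nonneg (z (i + 1 + 1) - z (i + 1) + (z (i + 1) - z i))]
  rw [sum_add_distrib, ← mul_sum, ← mul_sum] at h₁
  have h₂ := sum_range_succ (fun i => (z (i + 1) - z i) ^ 2) n
  have h₃ := sum_range_succ' (fun i => (z (i + 1) - z i) ^ 2) n
  have := sq_nonneg (z (n + 1) - z n)
  have := sq_nonneg (z (0 + 1) - z 0)
  linarith

theorem normSq_eq (n : ℕ) (h : ℝ) (v : ℕ → ℝ) :
    normSq (n + 1) h v = ∑ i ∈ Finset.range n, v (i + 1) ^ 2 * h := by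
  rw [normSq, Finset.sum_Ico_eq_sum_range]
  exact Finset.sum_congr rfl fun i _ => by rw [add_comm 1 i]

theorem normSqR_backDiff_eq (N : ℕ) {h : ℝ} (hh : h ≠ 0) (v : ℕ → ℝ) :
    normSqR N h (backDiff h v) = (∑ i ∈ Finset.range N, (v (i + 1) - v i) ^ 2) / h := by
  rw [normSqR, ← Finset.Ico_add_one_right_eq_Icc, Finset.sum_Ico_eq_sum_range, Finset.sum_div]
  refine Finset.sum_congr rfl fun i _ => ?_
  rw [add_comm 1 i, backDiff, Nat.add_sub_cancel]
  field_simp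

theorem normSq_nonneg (N : ℕ) {h : ℝ} (hh : 0 ≤ h) (v : ℕ → ℝ) : 0 ≤ normSq N h v :=
  Finset.sum_nonneg fun _ _ => mul_nonneg (sq_nonneg _) hh

theorem normSqR_nonneg (N : ℕ) {h : ℝ} (hh : 0 ≤ h) (v : ℕ → ℝ) : 0 ≤ normSqR N h v :=
  Finset.sum_nonneg fun _ _ => mul_nonneg (sq_nonneg _) hh

/-- Coercivity of the second difference with respect to the averaged inner product. -/
theorem normSqR_backDiff_le {N : ℕ} (hN : 1 ≤ N) {h : ℝ} (hh : 0 < h) {z : ℕ → ℝ} (hz : z 0 = 0)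
    (hzN : z N = 0) :
    2 / 3 * normSqR N h (backDiff h z) ≤
      -∑ i ∈ Finset.Ico 1 N, secondDiff h z i * avg h z i * h := by
  obtain ⟨n, rfl⟩ : ∃ n, N = n + 1 := ⟨N - 1, by omega⟩
  have e : ∑ i ∈ Finset.Ico 1 (n + 1), secondDiff h z i * avg h z i * h =
      (∑ i ∈ Finset.range n, (z (i + 2) - 2 * z (i + 1) + z i) * z (i + 1) +
        (∑ i ∈ Finset.range n, (z (i + 2) - 2 * z (i + 1) + z i) ^ 2) / 12) / h := by
    rw [Finset.sum_Ico_eq_sum_range, Finset.sum_div, ← Finset.sum_add_distrib, Finset.sum_div]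
    refine Finset.sum_congr rfl fun i _ => ?_
    rw [add_comm 1 i, avg, secondDiff, Nat.add_sub_cancel]
    field_simp
  -- Summation by parts gives the full gradient, and the `1/12` term of `avg` costs at most `4/12`
  -- of it: hence `2/3`.
  have h₁ := sum_second_mul z n
  have h₂ := sum_second_sq_le z n
  rw [hz, hzN] at h₁
  rw [e, normSqR_backDiff_eq _ hh.ne', ← neg_div, ← mul_div_assoc]
  exact div_le_div_of_nonneg_right (by linarith) hh.le

-- `avg` is a convex combination with weights `1/12, 10/12, 1/12`, so convexity of the square
-- applies; the shifted sums do not exceed the original one because the boundary values vanish.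
open Finset in
theorem normSq_avg_le {N : ℕ} (hN : 1 ≤ N) {h : ℝ} (hh : 0 < h) {z : ℕ → ℝ} (hz : z 0 = 0)
    (hzN : z N = 0) : normSq N h (avg h z) ≤ normSq N h z := by
  obtain ⟨n, rfl⟩ : ∃ n, N = n + 1 := ⟨N - 1, by omega⟩
  rw [normSq_eq, normSq_eq, ← sum_mul, ← sum_mul]
  refine mul_le_mul_of_nonneg_right ?_ hh.le
  have h₁ : ∑ i ∈ range n, avg h z (i + 1) ^ 2 ≤
      ∑ i ∈ range n, (1 / 12 * z (i + 1 + 1) ^ 2 + 10 / 12 * z (i + 1) ^ 2 + 1 / 12 * z i ^ 2) :=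
    sum_le_sum fun i _ => by
      rw [avg_eq hh.ne', Nat.add_sub_cancel]
      nlinarith [sq_nonneg (z (i + 1 + 1) - z (i + 1)), sq_nonneg (z (i + 1 + 1) - z i),
        sq_nonneg (z (i + 1) - z i)]
  rw [sum_add_distrib, sum_add_distrib, ← mul_sum, ← mul_sum, ← mul_sum] at h₁
  have h₂ := sum_range_succ (fun i => z i ^ 2) n
  have h₃ := sum_range_succ' (fun i => z i ^ 2) n
  have h₄ := sum_range_succ (fun i => z (i + 1) ^ 2) n
  have h₅ := sum_range_succ' (fun i => z (i + 1) ^ 2) n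
  simp only [hz, hzN] at h₂ h₃ h₄ h₅
  have := sq_nonneg (z n)
  have := sq_nonneg (z (0 + 1))
  linarith

open Finset in
/-- The discrete Poincaré inequality. -/
theorem normSq_le_normSqR_backDiff {N : ℕ} (hN : 1 ≤ N) {l h : ℝ} (hl : 0 < l) (hh : h = l / N)
    {z : ℕ → ℝ} (hz : z 0 = 0) : normSq N h z ≤ l ^ 2 * normSqR N h (backDiff h z) := by
  have hN' : (0 : ℝ) < N := by exact_mod_cast hN
  have hpos : 0 < h := by rw [hh]; positivity
  rw [normSqR_backDiff_eq _ hpos.ne']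
  set S := ∑ i ∈ range N, (z (i + 1) - z i) ^ 2 with hS
  have hS0 : 0 ≤ S := sum_nonneg fun _ _ => sq_nonneg _
  have h₁ : ∀ i ∈ Finset.Ico 1 N, z i ^ 2 * h ≤ N * S * h := by
    intro i hi
    have hi' := (Finset.mem_Ico.1 hi).2.le
    refine mul_le_mul_of_nonneg_right ?_ hpos.le
    have e : z i = ∑ r ∈ range i, (z (r + 1) - z r) := by rw [sum_range_sub, hz, sub_zero]
    have h₂ := sq_sum_le_card_mul_sum_sq (s := range i) (f := fun r => z (r + 1) - z r)
    rw [← e, card_range] at h₂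
    refine h₂.trans (mul_le_mul (by exact_mod_cast hi') ?_ (sum_nonneg fun _ _ => sq_nonneg _)
      hN'.le)
    exact sum_le_sum_of_subset_of_nonneg (range_mono hi') fun _ _ _ => sq_nonneg _
  have h₂ := sum_le_sum h₁
  rw [sum_const, Nat.card_Ico, nsmul_eq_mul] at h₂
  refine h₂.trans ?_
  have h₃ : ((N - 1 : ℕ) : ℝ) ≤ N := by exact_mod_cast Nat.sub_le N 1
  have hl' : l = N * h := by rw [hh]; field_simp
  calc ((N - 1 : ℕ) : ℝ) * (N * S * h) ≤ N * (N * S * h) :=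
        mul_le_mul_of_nonneg_right h₃ (by positivity)
    _ = l ^ 2 * (S / h) := by rw [hl']; field_simp

/-! ### A priori estimate -/

theorem l2Formula_linear (α τ p r : ℝ) (a b : ℕ → ℝ) (j : ℕ) :
    l2Formula α τ (fun s => p * a s + r * b s) j =
      p * l2Formula α τ a j + r * l2Formula α τ b j := by
  simp only [l2Formula, Finset.mul_sum, ← Finset.sum_add_distrib]
  exact Finset.sum_congr rfl fun s _ => by ring

theorem l2Formula_avg_sub (α τ : ℝ) {h : ℝ} (hh : h ≠ 0) (U y : ℕ → ℕ → ℝ) (i j : ℕ) :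
    l2Formula α τ (fun s => avg h (fun r => U s r - y s r) i) j =
      avg h (fun r => l2Formula α τ (fun s => U s r) j) i -
        l2Formula α τ (fun s => avg h (y s) i) j := by
  have e₁ : (fun s => avg h (fun r => U s r - y s r) i) = fun s =>
      1 * (1 / 12 * U s (i + 1) + 1 / 12 * (1 * U s (i - 1) + 10 * U s i)) +
        -1 * avg h (y s) i := by
    funext s; rw [avg_eq hh, avg_eq hh]; ring
  rw [e₁, l2Formula_linear, l2Formula_linear, l2Formula_linear, avg_eq hh]
  ring

theorem le_sum_mul_l2Formula {α T τ : ℝ} (hα0 : 0 < α) (hα1 : α < 1) (hT : 0 < T) {M : ℕ}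
    (hM : 1 ≤ M) (hτ : τ = T / M) (w : ℕ → ℝ) (hw : w 0 = 0) :
    -(3 * T ^ (1 - α) / Real.Gamma (2 - α) * w 1 ^ 2) ≤
      ∑ j ∈ Finset.Ico 1 M, w (j + 1) * l2Formula α τ w j * τ := by
  have hM' : (0 : ℝ) < M := by exact_mod_cast hM
  have hpos : 0 < τ := by rw [hτ]; positivity
  have hΓ : 0 < Real.Gamma (2 - α) := Real.Gamma_pos_of_pos (by linarith)
  have hTM : T = τ * M := by rw [hτ]; field_simp
  have h := mul_le_mul_of_nonneg_left (le_sum_mul_l2 hα0 hα1 hM w hw)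
    (by positivity : 0 ≤ τ ^ (1 - α) / Real.Gamma (2 - α))
  rw [hTM, Real.mul_rpow hpos.le hM'.le]
  refine le_trans (le_of_eq (by ring)) (h.trans_eq ?_)
  rw [Finset.mul_sum]
  refine Finset.sum_congr rfl fun j _ => ?_
  rw [l2Formula]
  simp only [← mul_div_assoc, ← Finset.sum_div]
  field_simp

open Finset in
/-- A priori estimate for the compact difference scheme. -/
theorem sum_normSqR_le {α l T c₁ R h τ : ℝ} (hα0 : 0 < α) (hα1 : α < 1) (hl : 0 < l) (hT : 0 < T)
    (hc₁ : 0 < c₁) {N M : ℕ} (hN : 1 ≤ N) (hM : 1 ≤ M) (hh : h = l / N) (hτ : τ = T / M)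
    {κ ρ : ℕ → ℝ} {z : ℕ → ℕ → ℝ} (hκ : ∀ j ∈ Finset.Ico 1 M, c₁ ≤ κ j)
    (hρ : ∀ j ∈ Finset.Ico 1 M, 0 ≤ ρ j)
    (hz₀ : ∀ i ≤ N, z 0 i = 0) (hzl : ∀ j ≤ M, z j 0 = 0) (hzr : ∀ j ≤ M, z j N = 0)
    (hR : ∀ j ∈ Finset.Ico 1 M, ∀ i ∈ Finset.Ico 1 N,
      |l2Formula α τ (fun s => avg h (z s) i) j -
        (κ j * secondDiff h (z (j + 1)) i - ρ j * avg h (z (j + 1)) i)| ≤ R) :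
    c₁ / 3 * ∑ j ∈ Finset.Ico 1 M, normSqR N h (backDiff h (z (j + 1))) * τ ≤
      3 * T ^ (1 - α) / Real.Gamma (2 - α) * normSq N h (z 1) +
        3 * l ^ 3 * T / (4 * c₁) * R ^ 2 := by
  have hN' : (0 : ℝ) < N := by exact_mod_cast hN
  have hM' : (0 : ℝ) < M := by exact_mod_cast hM
  have hpos : 0 < h := by rw [hh]; positivity
  have hτpos : 0 < τ := by rw [hτ]; positivity
  have hΓ : 0 < Real.Gamma (2 - α) := Real.Gamma_pos_of_pos (by linarith)
  have hlayer : ∀ j ∈ Finset.Ico 1 M,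
      c₁ / 3 * (normSqR N h (backDiff h (z (j + 1))) * τ) ≤
      -∑ i ∈ Finset.Ico 1 N, avg h (z (j + 1)) i *
        l2Formula α τ (fun s => avg h (z s) i) j * τ * h + 3 * l ^ 3 / (4 * c₁) * R ^ 2 * τ := by
    intro j hj
    have hjM : j + 1 ≤ M := (Finset.mem_Ico.1 hj).2
    set g := z (j + 1) with hg
    have hg0 : g 0 = 0 := hzl _ hjM
    have hgN : g N = 0 := hzr _ hjM
    have hcoer := normSqR_backDiff_le hN hpos hg0 hgN
    have havg := normSq_avg_le hN hpos hg0 hgN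
    have hpoin := normSq_le_normSqR_backDiff hN hl hh hg0
    have hS0 : 0 ≤ normSqR N h (backDiff h g) := normSqR_nonneg N hpos.le _
    have hpt : ∀ i ∈ Finset.Ico 1 N, avg h g i * l2Formula α τ (fun s => avg h (z s) i) j * h ≤
        κ j * (secondDiff h g i * avg h g i * h) + c₁ / (3 * l ^ 2) * (avg h g i ^ 2 * h) +
          3 * l ^ 2 / (4 * c₁) * R ^ 2 * h := by
      intro i hi
      set r := l2Formula α τ (fun s => avg h (z s) i) j -
        (κ j * secondDiff h g i - ρ j * avg h g i) with hr
      have hr2 : r ^ 2 ≤ R ^ 2 := by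
        have := pow_le_pow_left₀ (abs_nonneg r) (hR j hj i hi) 2
        rwa [sq_abs] at this
      -- Young's inequality, with the weight chosen so that after the Poincaré inequality the first
      -- term uses up `c₁ / 3`, half of the coercivity constant `2 c₁ / 3`.
      have hy : avg h g i * r ≤ c₁ / (3 * l ^ 2) * avg h g i ^ 2 + 3 * l ^ 2 / (4 * c₁) * r ^ 2 := by
        have e : c₁ / (3 * l ^ 2) * avg h g i ^ 2 + 3 * l ^ 2 / (4 * c₁) * r ^ 2 - avg h g i * r =
            (2 * c₁ * avg h g i - 3 * l ^ 2 * r) ^ 2 / (12 * c₁ * l ^ 2) := by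
          field_simp; ring
        have : 0 ≤ (2 * c₁ * avg h g i - 3 * l ^ 2 * r) ^ 2 / (12 * c₁ * l ^ 2) := by positivity
        linarith
      have hR2 : 3 * l ^ 2 / (4 * c₁) * r ^ 2 ≤ 3 * l ^ 2 / (4 * c₁) * R ^ 2 :=
        mul_le_mul_of_nonneg_left hr2 (by positivity)
      have hq : 0 ≤ ρ j * avg h g i ^ 2 := mul_nonneg (hρ j hj) (sq_nonneg _)
      have e : avg h g i * l2Formula α τ (fun s => avg h (z s) i) j =
          κ j * (secondDiff h g i * avg h g i) - ρ j * avg h g i ^ 2 + avg h g i * r := by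
        rw [hr]; ring
      have : avg h g i * l2Formula α τ (fun s => avg h (z s) i) j ≤
          κ j * (secondDiff h g i * avg h g i) + c₁ / (3 * l ^ 2) * avg h g i ^ 2 +
            3 * l ^ 2 / (4 * c₁) * R ^ 2 := by linarith
      calc _ ≤ _ := mul_le_mul_of_nonneg_right this hpos.le
        _ = _ := by ring
    have hsum := sum_le_sum hpt
    rw [sum_add_distrib, sum_add_distrib, ← mul_sum, ← mul_sum, sum_const, Nat.card_Ico,
      nsmul_eq_mul] at hsum
    change _ ≤ _ + c₁ / (3 * l ^ 2) * normSq N h (avg h g) + _ at hsum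
    have h₁ : c₁ / (3 * l ^ 2) * normSq N h (avg h g) ≤ c₁ / 3 * normSqR N h (backDiff h g) := by
      refine (mul_le_mul_of_nonneg_left (havg.trans hpoin) (by positivity)).trans_eq ?_
      field_simp
    have h₂ : c₁ * (2 / 3 * normSqR N h (backDiff h g)) ≤
        κ j * -∑ i ∈ Finset.Ico 1 N, secondDiff h g i * avg h g i * h :=
      mul_le_mul (hκ j hj) hcoer (by positivity) (hc₁.le.trans (hκ j hj))
    have h₃ : ((N - 1 : ℕ) : ℝ) * (3 * l ^ 2 / (4 * c₁) * R ^ 2 * h) ≤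
        3 * l ^ 3 / (4 * c₁) * R ^ 2 := by
      have hl' : l = N * h := by rw [hh]; field_simp
      have : ((N - 1 : ℕ) : ℝ) ≤ N := by exact_mod_cast Nat.sub_le N 1
      calc _ ≤ N * (3 * l ^ 2 / (4 * c₁) * R ^ 2 * h) :=
            mul_le_mul_of_nonneg_right this (by positivity)
        _ = 3 * (l ^ 2 * (N * h)) / (4 * c₁) * R ^ 2 := by ring
        _ = _ := by rw [← hl']; ring
    have h₄ : c₁ / 3 * normSqR N h (backDiff h g) ≤
        -∑ i ∈ Finset.Ico 1 N, avg h g i * l2Formula α τ (fun s => avg h (z s) i) j * h +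
          3 * l ^ 3 / (4 * c₁) * R ^ 2 := by linarith
    calc c₁ / 3 * (normSqR N h (backDiff h g) * τ) = c₁ / 3 * normSqR N h (backDiff h g) * τ := by
          ring
      _ ≤ _ := mul_le_mul_of_nonneg_right h₄ hτpos.le
      _ = _ := by
        rw [add_mul, neg_mul, sum_mul]
        congr 2
        exact sum_congr rfl fun i _ => by ring
  have hsum := sum_le_sum hlayer
  rw [← mul_sum, sum_add_distrib, sum_neg_distrib, sum_comm, sum_const, Nat.card_Ico,
    nsmul_eq_mul] at hsum
  -- With the sums exchanged, positivity in time is applied at each spatial node to the averaged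
  -- error.
  have htime : -(3 * T ^ (1 - α) / Real.Gamma (2 - α) * normSq N h (z 1)) ≤
      ∑ i ∈ Finset.Ico 1 N, ∑ j ∈ Finset.Ico 1 M, avg h (z (j + 1)) i *
        l2Formula α τ (fun s => avg h (z s) i) j * τ * h := by
    have h₁ : ∀ i ∈ Finset.Ico 1 N,
        -(3 * T ^ (1 - α) / Real.Gamma (2 - α)) * (avg h (z 1) i ^ 2 * h) ≤
        ∑ j ∈ Finset.Ico 1 M, avg h (z (j + 1)) i *
          l2Formula α τ (fun s => avg h (z s) i) j * τ * h := by
      intro i hi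
      have hi' := Finset.mem_Ico.1 hi
      have h₀ : avg h (z 0) i = 0 := by
        rw [avg_eq hpos.ne', hz₀ _ (by omega), hz₀ _ (by omega), hz₀ _ (by omega)]; simp
      have := mul_le_mul_of_nonneg_right
        (le_sum_mul_l2Formula hα0 hα1 hT hM hτ (fun s => avg h (z s) i) h₀) hpos.le
      rw [sum_mul] at this
      exact le_trans (le_of_eq (by ring)) this
    refine le_trans ?_ (sum_le_sum h₁)
    rw [← mul_sum]
    change _ ≤ -(3 * T ^ (1 - α) / Real.Gamma (2 - α)) * normSq N h (avg h (z 1))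
    have := mul_le_mul_of_nonneg_left (normSq_avg_le hN hpos (hzl 1 hM) (hzr 1 hM))
      (by positivity : 0 ≤ 3 * T ^ (1 - α) / Real.Gamma (2 - α))
    linarith
  have h₃ : ((M - 1 : ℕ) : ℝ) * (3 * l ^ 3 / (4 * c₁) * R ^ 2 * τ) ≤
      3 * l ^ 3 * T / (4 * c₁) * R ^ 2 := by
    have hT' : T = M * τ := by rw [hτ]; field_simp
    have : ((M - 1 : ℕ) : ℝ) ≤ M := by exact_mod_cast Nat.sub_le M 1
    calc _ ≤ M * (3 * l ^ 3 / (4 * c₁) * R ^ 2 * τ) :=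
          mul_le_mul_of_nonneg_right this (by positivity)
      _ = 3 * l ^ 3 * (M * τ) / (4 * c₁) * R ^ 2 := by ring
      _ = _ := by rw [← hT']
  linarith

open Finset in
/-- Passage from the a priori estimate to the convergence rate. -/
theorem sqrt_sum_le {l c₁ A B C₁ Cr ε h τ : ℝ} (hl : 0 < l) (hc₁ : 0 < c₁) (hA : 0 ≤ A)
    (hB : 0 ≤ B) (hε : 0 < ε) (hτ : 0 < τ) {N M : ℕ} (hN : 1 ≤ N) (hh : h = l / N)
    {z : ℕ → ℕ → ℝ} (hzl : ∀ j ≤ M, z j 0 = 0)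
    (hfirst : Real.sqrt (normSq N h (z 1)) ≤ C₁ * ε)
    (hest : c₁ / 3 * ∑ j ∈ Finset.Ico 1 M, normSqR N h (backDiff h (z (j + 1))) * τ ≤
      A * normSq N h (z 1) + B * (Cr * ε) ^ 2) :
    Real.sqrt (∑ j ∈ Finset.Ico 1 M,
      (normSq N h (z (j + 1)) + normSqR N h (backDiff h (z (j + 1)))) * τ) ≤
      Real.sqrt ((l ^ 2 + 1) * (3 / c₁ * (A * C₁ ^ 2 + B * Cr ^ 2))) * ε := by
  have hN' : (0 : ℝ) < N := by exact_mod_cast hN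
  have hpos : 0 < h := by rw [hh]; positivity
  have hz1 : normSq N h (z 1) ≤ C₁ ^ 2 * ε ^ 2 := by
    have h₁ := pow_le_pow_left₀ (Real.sqrt_nonneg _) hfirst 2
    rwa [Real.sq_sqrt (normSq_nonneg N hpos.le _), mul_pow] at h₁
  set S := ∑ j ∈ Finset.Ico 1 M, normSqR N h (backDiff h (z (j + 1))) * τ with hS
  have hSle : S ≤ 3 / c₁ * (A * C₁ ^ 2 + B * Cr ^ 2) * ε ^ 2 := by
    have h₁ : c₁ / 3 * S ≤ (A * C₁ ^ 2 + B * Cr ^ 2) * ε ^ 2 := by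
      have := mul_le_mul_of_nonneg_left hz1 hA
      linarith
    calc S = 3 / c₁ * (c₁ / 3 * S) := by field_simp
      _ ≤ 3 / c₁ * ((A * C₁ ^ 2 + B * Cr ^ 2) * ε ^ 2) :=
        mul_le_mul_of_nonneg_left h₁ (by positivity)
      _ = _ := by ring
  have htotal : ∑ j ∈ Finset.Ico 1 M,
      (normSq N h (z (j + 1)) + normSqR N h (backDiff h (z (j + 1)))) * τ ≤
      (l ^ 2 + 1) * (3 / c₁ * (A * C₁ ^ 2 + B * Cr ^ 2)) * ε ^ 2 := by
    calc _ ≤ ∑ j ∈ Finset.Ico 1 M,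
          (l ^ 2 + 1) * (normSqR N h (backDiff h (z (j + 1))) * τ) := by
          refine sum_le_sum fun j hj => ?_
          rw [← mul_assoc]
          refine mul_le_mul_of_nonneg_right ?_ hτ.le
          have := normSq_le_normSqR_backDiff hN hl hh (hzl (j + 1) (Finset.mem_Ico.1 hj).2)
          linarith
      _ = (l ^ 2 + 1) * S := by rw [← mul_sum]
      _ ≤ (l ^ 2 + 1) * (3 / c₁ * (A * C₁ ^ 2 + B * Cr ^ 2) * ε ^ 2) :=
          mul_le_mul_of_nonneg_left hSle (by positivity)
      _ = _ := by ring
  calc _ ≤ Real.sqrt ((l ^ 2 + 1) * (3 / c₁ * (A * C₁ ^ 2 + B * Cr ^ 2)) * ε ^ 2) :=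
        Real.sqrt_le_sqrt htotal
    _ = _ := by rw [Real.sqrt_mul (by positivity), Real.sqrt_sq hε.le]

/-! ### Residual of the exact solution in the scheme -/

theorem diffusionOp_eq {k q : ℝ → ℝ} {u : ℝ → ℝ → ℝ} {l t x : ℝ} (hl : 0 < l)
    (hu : ContDiffOn ℝ 6 (fun x => u x t) (Icc 0 l)) (hx : x ∈ Ioo 0 l) :
    diffusionOp (fun _ t => k t) (fun _ t => q t) u x t =
      k t * iteratedDerivWithin 2 (fun x => u x t) (Icc 0 l) x - q t * u x t := by
  obtain ⟨U, hU, hUu⟩ := exists_contDiff_eqOn hl 6 _ hu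
  rw [← iteratedDeriv_eq_iteratedDerivWithin hl (by norm_num) hU hUu (Ioo_subset_Icc_self hx)]
  have hev : ∀ y ∈ Ioo 0 l, (fun η => u η t) =ᶠ[nhds y] U := fun y hy => by
    filter_upwards [Ioo_mem_nhds hy.1 hy.2] with z hz
    exact (hUu (Ioo_subset_Icc_self hz)).symm
  have hev' : (fun ξ => k t * deriv (fun η => u η t) ξ) =ᶠ[nhds x] fun ξ => k t * deriv U ξ := by
    filter_upwards [Ioo_mem_nhds hx.1 hx.2] with z hz
    rw [(hev z hz).deriv_eq]
  rw [diffusionOp, hev'.deriv_eq, deriv_const_mul_field, iteratedDeriv_succ, iteratedDeriv_one]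

/-- The equation holds up to the truncation error of the L2 formula, up to the boundary. -/
theorem abs_l2Formula_sub_le {α l T : ℝ} (hα0 : 0 < α) (hα1 : α < 1) (hl : 0 < l) (hT : 0 < T)
    {k q : ℝ → ℝ} {f : ℝ → ℝ → ℝ} {u₀ : ℝ → ℝ} {u : ℝ → ℝ → ℝ}
    (hf : ∀ t ∈ Ioc 0 T, ContinuousOn (fun x => f x t) (Icc 0 l))
    (hu : IsSolution α l T (fun _ t => k t) (fun _ t => q t) f u₀ u) (hu63 : IsC 6 3 l T u)
    {K τ : ℝ} {j : ℕ} (hτ : 0 < τ) (hj : 1 ≤ j) (hjT : (j + 1 : ℕ) * τ ≤ T)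
    (hK : ∀ x ∈ Icc 0 l, ∀ t ∈ Icc 0 T,
      |iteratedDerivWithin 3 (fun t => u x t) (Icc 0 T) t| ≤ K) {x : ℝ} (hx : x ∈ Icc 0 l) :
    |l2Formula α τ (fun s => u x (s * τ)) j - (k ((j + 1 : ℕ) * τ) *
      iteratedDerivWithin 2 (fun x => u x ((j + 1 : ℕ) * τ)) (Icc 0 l) x -
      q ((j + 1 : ℕ) * τ) * u x ((j + 1 : ℕ) * τ) + f x ((j + 1 : ℕ) * τ))| ≤
      truncConst α * K * τ ^ (3 - α) := by
  set t : ℝ := (j + 1 : ℕ) * τ with ht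
  have htT : t ∈ Ioc 0 T := ⟨by positivity, hjT⟩
  have hmem : ∀ i : ℕ, i ≤ j + 1 → (i : ℝ) * τ ∈ Icc 0 T := fun i hi =>
    ⟨by positivity, le_trans (mul_le_mul_of_nonneg_right (by exact_mod_cast hi) hτ.le) hjT⟩
  have hcu : ∀ s ∈ Icc 0 T, ContinuousOn (fun x => u x s) (Icc 0 l) := fun s hs =>
    (hu63.contDiff_x s hs).continuousOn
  have hcl : closure (Ioo 0 l) = Icc 0 l := closure_Ioo hl.ne
  rw [← hcl] at hx
  -- The differential equation is assumed only for `0 < x < l`, whereas averaging at `i = 1` and `i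
  -- = N - 1` uses boundary nodes. The inequality, rather than the equation, passes to the closure,
  -- so continuity of the Caputo derivative in `x` is not needed.
  refine le_on_closure (f := fun x => |l2Formula α τ (fun s => u x (s * τ)) j - (k t *
      iteratedDerivWithin 2 (fun x => u x t) (Icc 0 l) x - q t * u x t + f x t)|)
    (g := fun _ => truncConst α * K * τ ^ (3 - α)) (fun y hy => ?_) ?_ continuousOn_const hx
  · have hy' := Ioo_subset_Icc_self hy
    have h := abs_l2Formula_sub_caputo_le hα0 hα1 hT hτ hj hjT (hu63.contDiff_t y hy') (hK y hy')
    rw [hu.equation y hy _ htT, diffusionOp_eq hl (hu63.contDiff_x _ (Ioc_subset_Icc_self htT)) hy]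
      at h
    exact h
  · rw [hcl]
    have h₁ : ContinuousOn (fun x => iteratedDerivWithin 2 (fun x => u x t) (Icc 0 l) x)
        (Icc 0 l) :=
      (hu63.contDiff_x t (Ioc_subset_Icc_self htT)).continuousOn_iteratedDerivWithin (by norm_num)
        (uniqueDiffOn_Icc hl)
    have h₂ : ContinuousOn (fun x => l2Formula α τ (fun s => u x (s * τ)) j) (Icc 0 l) := by
      unfold l2Formula
      refine continuousOn_const.mul (continuousOn_finsetSum _ fun s hs => ?_)
      have hs' : s ≤ j := by simpa [Nat.lt_succ_iff] using hs
      exact continuousOn_const.mul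
        (((hcu _ (hmem _ (by omega))).sub (hcu _ (hmem _ (by omega)))).div_const _)
    exact (h₂.sub (((continuousOn_const.mul h₁).sub
      (continuousOn_const.mul (hcu t (Ioc_subset_Icc_self htT)))).add (hf t htT))).abs

theorem abs_avg_le {h : ℝ} (hh : h ≠ 0) {v : ℕ → ℝ} {i : ℕ} {C : ℝ} (h₁ : |v (i + 1)| ≤ C)
    (h₂ : |v i| ≤ C) (h₃ : |v (i - 1)| ≤ C) : |avg h v i| ≤ C := by
  rw [avg_eq hh]
  rw [abs_le] at *
  constructor <;> linarith

/-- The residual of the error in the compact scheme. -/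
theorem abs_residual_le {α l T kb : ℝ} (hα0 : 0 < α) (hα1 : α < 1) (hl : 0 < l) (hT : 0 < T)
    {k q : ℝ → ℝ} {f : ℝ → ℝ → ℝ} {u₀ : ℝ → ℝ} {u : ℝ → ℝ → ℝ} (hkb : ∀ t ∈ Icc 0 T, |k t| ≤ kb)
    (hf : ∀ t ∈ Ioc 0 T, ContinuousOn (fun x => f x t) (Icc 0 l))
    (hu : IsSolution α l T (fun _ t => k t) (fun _ t => q t) f u₀ u) (hu63 : IsC 6 3 l T u)
    {N M : ℕ} (hN : 1 ≤ N) (hM : 1 ≤ M) {y : ℕ → ℕ → ℝ} {h τ : ℝ} (hh : h = l / N)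
    (hτ : τ = T / M) (hy : IsSchemeSolution α l T k q f u₀ N M y) {Kt Kx : ℝ}
    (hKt : ∀ x ∈ Icc 0 l, ∀ t ∈ Icc 0 T,
      |iteratedDerivWithin 3 (fun t => u x t) (Icc 0 T) t| ≤ Kt)
    (hKx : ∀ x ∈ Icc 0 l, ∀ t ∈ Icc 0 T,
      |iteratedDerivWithin 6 (fun x => u x t) (Icc 0 l) x| ≤ Kx)
    {i j : ℕ} (hj : j ∈ Finset.Ico 1 M) (hi : i ∈ Finset.Ico 1 N) :
    |l2Formula α τ (fun s => avg h (gridError h τ u y s) i) j -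
      (k ((j + 1 : ℕ) * τ) * secondDiff h (gridError h τ u y (j + 1)) i -
        q ((j + 1 : ℕ) * τ) * avg h (gridError h τ u y (j + 1)) i)| ≤
      truncConst α * Kt * τ ^ (3 - α) + kb * (3 * Kx * h ^ 4) := by
  have hN' : (0 : ℝ) < N := by exact_mod_cast hN
  have hM' : (0 : ℝ) < M := by exact_mod_cast hM
  have hpos : 0 < h := by rw [hh]; positivity
  have hτpos : 0 < τ := by rw [hτ]; positivity
  have hi' := Finset.mem_Ico.1 hi
  have hj' := Finset.mem_Ico.1 hj
  have hjT : (j + 1 : ℕ) * τ ≤ T := by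
    have : ((j + 1 : ℕ) : ℝ) ≤ M := by exact_mod_cast hj'.2
    calc _ ≤ M * τ := mul_le_mul_of_nonneg_right this hτpos.le
      _ = T := by rw [hτ]; field_simp
  have hxmem : ∀ r : ℕ, r ≤ N → (r : ℝ) * h ∈ Icc 0 l := fun r hr => by
    refine ⟨by positivity, ?_⟩
    have : (r : ℝ) ≤ N := by exact_mod_cast hr
    calc _ ≤ N * h := mul_le_mul_of_nonneg_right this hpos.le
      _ = l := by rw [hh]; field_simp
  set t : ℝ := (j + 1 : ℕ) * τ with ht
  have htT : t ∈ Icc 0 T := ⟨by positivity, hjT⟩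
  set D : ℝ → ℝ := iteratedDerivWithin 2 (fun x => u x t) (Icc 0 l) with hD
  set e : ℕ → ℝ := fun r => l2Formula α τ (fun s => u (r * h) (s * τ)) j -
    (k t * D (r * h) - q t * u (r * h) t + f (r * h) t) with he
  have heb : ∀ r ≤ N, |e r| ≤ truncConst α * Kt * τ ^ (3 - α) := fun r hr =>
    abs_l2Formula_sub_le hα0 hα1 hl hT hf hu hu63 hτpos hj'.1 hjT hKt (hxmem r hr)
  have he_avg : |avg h e i| ≤ truncConst α * Kt * τ ^ (3 - α) :=
    abs_avg_le hpos.ne' (heb _ (by omega)) (heb _ (by omega)) (heb _ (by omega))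
  have hspace : |avg h (fun r => D (r * h)) i - secondDiff h (fun r => u (r * h) t) i| ≤
      3 * Kx * h ^ 4 := by
    obtain ⟨U, hU, hUu⟩ := exists_contDiff_eqOn hl 6 _ (hu63.contDiff_x t htT)
    have e₁ : ((i + 1 : ℕ) : ℝ) * h = i * h + h := by push_cast; ring
    have e₂ : ((i - 1 : ℕ) : ℝ) * h = i * h - h := by rw [Nat.cast_sub hi'.1]; push_cast; ring
    have hsub : ∀ y ∈ Icc (i * h - h) (i * h + h), y ∈ Icc 0 l := fun y hy =>
      ⟨(e₂ ▸ (hxmem (i - 1) (by omega)).1).trans hy.1,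
        hy.2.trans (e₁ ▸ (hxmem (i + 1) (by omega)).2)⟩
    have h₁ := abs_avg_sub_secondDiff_le hpos hU (x := i * h) (K := Kx) fun y hy => by
      rw [iteratedDeriv_eq_iteratedDerivWithin hl le_rfl hU hUu (hsub y hy)]
      exact hKx y (hsub y hy) t htT
    rw [avg_eq hpos.ne', secondDiff]
    have hDU : ∀ y ∈ Icc (i * h - h) (i * h + h), D y = iteratedDeriv 2 U y := fun y hy =>
      (iteratedDeriv_eq_iteratedDerivWithin hl (by norm_num) hU hUu (hsub y hy)).symm
    have hUD : ∀ y ∈ Icc (i * h - h) (i * h + h), u y t = U y := fun y hy =>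
      (hUu (hsub y hy)).symm
    have m₁ : i * h + h ∈ Icc (i * h - h) (i * h + h) := ⟨by linarith, by linarith⟩
    have m₂ : i * h - h ∈ Icc (i * h - h) (i * h + h) := ⟨by linarith, by linarith⟩
    have m₃ : i * h ∈ Icc (i * h - h) (i * h + h) := ⟨by linarith, by linarith⟩
    rw [e₁, e₂, hDU _ m₁, hDU _ m₂, hDU _ m₃, hUD _ m₁, hUD _ m₂, hUD _ m₃]
    exact h₁
  have hscheme := hy.equation j hj i hi
  rw [← hh, ← hτ, ← ht] at hscheme
  have hl2 := l2Formula_avg_sub α τ hpos.ne' (fun s r => u (r * h) (s * τ)) y i j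
  -- Averaging the nodal time errors `e` cancels `f` against the scheme; `k t`, independent of `x`,
  -- passes through `avg` and leaves only the spatial error.
  have key : l2Formula α τ (fun s => avg h (gridError h τ u y s) i) j -
      (k t * secondDiff h (gridError h τ u y (j + 1)) i -
        q t * avg h (gridError h τ u y (j + 1)) i) =
      avg h e i + k t *
        (avg h (fun r => D (r * h)) i - secondDiff h (fun r => u (r * h) t) i) := by
    change l2Formula α τ (fun s => avg h (fun r => u (r * h) (s * τ) - y s r) i) j - _ = _
    rw [hl2, hscheme]
    simp only [avg_eq hpos.ne', secondDiff, he, gridError, ← ht]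
    ring
  rw [key]
  refine (abs_add_le _ _).trans (add_le_add he_avg ?_)
  rw [abs_mul]
  exact mul_le_mul (hkb t htT) hspace (abs_nonneg _) ((abs_nonneg _).trans (hkb t htT))

end CompactScheme

end

/-! ### The convergence theorem -/

theorem theorem3 (α l T c₁ : ℝ) (hα0 : 0 < α) (hα1 : α < 1) (hl : 0 < l) (hT : 0 < T)
    (hc₁ : 0 < c₁) (k q : ℝ → ℝ) (f : ℝ → ℝ → ℝ) (u₀ : ℝ → ℝ) (u : ℝ → ℝ → ℝ)
    (hk : ∀ t ∈ Set.Icc 0 T, c₁ ≤ k t)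
    (hkb : BddAbove (k '' Set.Icc 0 T))
    (hq : ∀ t ∈ Set.Icc 0 T, 0 ≤ q t)
    (hf : ∀ t ∈ Set.Ioc 0 T, ContinuousOn (fun x => f x t) (Set.Icc 0 l))
    (hu : CompactScheme.IsSolution α l T (fun _ t => k t) (fun _ t => q t) f u₀ u)
    (hu63 : CompactScheme.IsC 6 3 l T u) (C₁ : ℝ) :
    ∃ C_R : ℝ, 0 < C_R ∧ ∀ N M : ℕ, 1 ≤ N → 1 ≤ M → ∀ y : ℕ → ℕ → ℝ, ∀ h τ : ℝ,
      h = l / N → τ = T / M →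
      CompactScheme.IsSchemeSolution α l T k q f u₀ N M y →
      Real.sqrt (CompactScheme.normSq N h (CompactScheme.gridError h τ u y 1))
        ≤ C₁ * (τ ^ (3 - α) + h ^ 4) →
      Real.sqrt (∑ j ∈ Finset.Ico 1 M,
          (CompactScheme.normSq N h (CompactScheme.gridError h τ u y (j + 1))
            + CompactScheme.normSqR N h
                (CompactScheme.backDiff h (CompactScheme.gridError h τ u y (j + 1)))) * τ)
        ≤ C_R * (τ ^ (3 - α) + h ^ 4) := by
  obtain ⟨kb, hkb⟩ := hkb
  have hkb' : ∀ t ∈ Set.Icc 0 T, |k t| ≤ kb := fun t ht => by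
    rw [abs_of_pos (hc₁.trans_le (hk t ht))]
    exact hkb ⟨t, ht, rfl⟩
  have hkb0 : 0 ≤ kb := (abs_nonneg _).trans (hkb' 0 ⟨le_rfl, hT.le⟩)
  have hcomp : IsCompact (Set.Icc 0 l ×ˢ Set.Icc 0 T) := isCompact_Icc.prod isCompact_Icc
  obtain ⟨Kt, hKt⟩ := hcomp.exists_bound_of_continuousOn (hu63.continuous_t 3 le_rfl)
  obtain ⟨Kx, hKx⟩ := hcomp.exists_bound_of_continuousOn (hu63.continuous_x 6 le_rfl)
  have hKt0 : 0 ≤ Kt := (norm_nonneg _).trans (hKt (0, 0) ⟨⟨le_rfl, hl.le⟩, ⟨le_rfl, hT.le⟩⟩)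
  have hKx0 : 0 ≤ Kx := (norm_nonneg _).trans (hKx (0, 0) ⟨⟨le_rfl, hl.le⟩, ⟨le_rfl, hT.le⟩⟩)
  have hΓ : 0 < Real.Gamma (2 - α) := Real.Gamma_pos_of_pos (by linarith)
  have htc : 0 ≤ CompactScheme.truncConst α := by
    have h₁ : 0 < 1 - α := by linarith
    have h₂ : 0 < Real.Gamma (1 - α) := Real.Gamma_pos_of_pos h₁
    unfold CompactScheme.truncConst
    positivity
  set Cr : ℝ := CompactScheme.truncConst α * Kt + kb * (3 * Kx) with hCr
  set A : ℝ := 3 * T ^ (1 - α) / Real.Gamma (2 - α) with hA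
  set B : ℝ := 3 * l ^ 3 * T / (4 * c₁) with hB
  have hA0 : 0 ≤ A := by positivity
  have hB0 : 0 ≤ B := by positivity
  -- The summand `1` only ensures that the constant is strictly positive.
  refine ⟨Real.sqrt ((l ^ 2 + 1) * (3 / c₁ * (A * C₁ ^ 2 + B * Cr ^ 2))) + 1, by positivity, ?_⟩
  intro N M hN hM y h τ hh hτ hy hfirst
  have hN' : (0 : ℝ) < N := by exact_mod_cast hN
  have hM' : (0 : ℝ) < M := by exact_mod_cast hM
  have hpos : 0 < h := by rw [hh]; positivity
  have hτpos : 0 < τ := by rw [hτ]; positivity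
  have hlN : (N : ℝ) * h = l := by rw [hh]; field_simp
  have hTM : (M : ℝ) * τ = T := by rw [hτ]; field_simp
  have htmem : ∀ j : ℕ, j ≤ M → (j : ℝ) * τ ∈ Set.Icc 0 T := fun j hj => by
    refine ⟨by positivity, hTM ▸ ?_⟩
    exact mul_le_mul_of_nonneg_right (by exact_mod_cast hj) hτpos.le
  set ε : ℝ := τ ^ (3 - α) + h ^ 4 with hε
  have hτ3 : 0 < τ ^ (3 - α) := by positivity
  have hh4 : 0 < h ^ 4 := by positivity
  have hε0 : 0 < ε := by positivity
  set z := CompactScheme.gridError h τ u y with hz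
  have hz₀ : ∀ i ≤ N, z 0 i = 0 := fun i hi => by
    have : (i : ℝ) * h ∈ Set.Icc 0 l := by
      refine ⟨by positivity, hlN ▸ ?_⟩
      exact mul_le_mul_of_nonneg_right (by exact_mod_cast hi) hpos.le
    simp only [hz, CompactScheme.gridError]
    rw [hy.initial i hi, ← hh, Nat.cast_zero, zero_mul, hu.initial _ this, sub_self]
  have hzl : ∀ j ≤ M, z j 0 = 0 := fun j hj => by
    simp only [hz, CompactScheme.gridError]
    rw [hy.left j hj, Nat.cast_zero, zero_mul, hu.left _ (htmem j hj), sub_self]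
  have hzr : ∀ j ≤ M, z j N = 0 := fun j hj => by
    simp only [hz, CompactScheme.gridError]
    rw [hy.right j hj, hlN, hu.right _ (htmem j hj), sub_self]
  have hmem1 : ∀ j ∈ Finset.Ico 1 M, ((j + 1 : ℕ) : ℝ) * τ ∈ Set.Icc 0 T := fun j hj =>
    htmem _ (Finset.mem_Ico.1 hj).2
  have hest := CompactScheme.sum_normSqR_le hα0 hα1 hl hT hc₁ hN hM hh hτ (R := Cr * ε)
    (κ := fun j => k ((j + 1 : ℕ) * τ)) (ρ := fun j => q ((j + 1 : ℕ) * τ)) (z := z)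
    (fun j hj => hk _ (hmem1 j hj)) (fun j hj => hq _ (hmem1 j hj)) hz₀ hzl hzr
    (fun j hj i hi => by
      refine (CompactScheme.abs_residual_le hα0 hα1 hl hT hkb' hf hu hu63 hN hM hh hτ hy
        (fun x hx t ht => hKt (x, t) ⟨hx, ht⟩) (fun x hx t ht => hKx (x, t) ⟨hx, ht⟩)
        hj hi).trans ?_
      have h₁ : 0 ≤ CompactScheme.truncConst α * Kt := by positivity
      have h₂ : 0 ≤ kb * (3 * Kx) := by positivity
      rw [hCr, hε]
      linarith [mul_nonneg h₁ hh4.le, mul_nonneg h₂ hτ3.le])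
  refine (CompactScheme.sqrt_sum_le hl hc₁ hA0 hB0 hε0 hτpos hN hh hzl hfirst hest).trans ?_
  exact mul_le_mul_of_nonneg_right (le_add_of_nonneg_right zero_le_one) hε0.le
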